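/- All functions live on the interval $(-1,1)$. For $\alpha\ge 0$, $i\in\{1,2\}$ and $u\in L^2(-1,1)$ let $$TV^i_\alpha(u)=\sup\Big\{\int_{-1}^1 u\,\phi^{(i)}\,dx:\ \phi\in C_c^\infty(-1,1),\ \|\phi\|_{L^\infty}\le\alpha\Big\},\qquad TV:=TV^1_1,$$ and for $\lambda_1,\lambda_2\ge 0$ let $$TGV_{\lambda_1,\lambda_2}(u)=\sup\Big\{\int_{-1}^1 u\,\phi''\,dx:\ \phi\in C_c^\infty(-1,1),\ \|\phi'\|_{L^\infty}\le\lambda_1,\ \|\phi\|_{L^\infty}\le\lambda_2\Big\}.$$ For $g\in L^2(-1,1)$ put $\|g\|_{*,TV}=\sup\{\int_{-1}^1 g\,u\,dx:\ u\in L^2(-1,1),\ TV(u)\le 1\}\in[0,\infty]$, and $\sigma^1[g](x)=\int_{-1}^x g(t)\,dt$, $\sigma^2[g](x)=\int_{-1}^x\sigma^1[g](t)\,dt$. Let $u^\delta=\mathbf 1_{[-1/2,1/2]}-\tfrac12$. For $\alpha\ge0$ and $i\in\{1,2\}$ let $v^{(i)}_\alpha$ be the unique minimizer over $L^2(-1,1)$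 of $u\mapsto\frac12\int_{-1}^1(u-u^\delta)^2\,dx+TV^i_\alpha(u)$, and write $v^{(i)*}_\alpha=v^{(i)}_\alpha-u^\delta$. Let $$\Lambda=\big\{(\lambda_1,\lambda_2)\in[0,\infty)^2:\ \lambda_1<\|\sigma^1[v^{(2)*}_{\lambda_2}]\|_{L^\infty}\ \text{ and }\ \lambda_2<\|\sigma^2[v^{(1)*}_{\lambda_1}]\|_{L^\infty}\big\}.$$ **Theorem.** Let $(\lambda_1,\lambda_2)\in\Lambda$ and let $\mu_1,\mu_2\ge0$ be such that $$\lambda_2=\frac{\mu_1\mu_2}{\|u^\delta\|_{*,TV}},\qquad \lambda_1=\frac{\mu_1}{\|u^\delta\|_{*,TV}}\,\|v^{(2)*}_{\mu_2}\|_{*,TV}.$$ Then $0<\|u^\delta\|_{*,TV}<\infty$ and $\|v^{(2)*}_{\mu_2}\|_{*,TV}<\infty$ (so that these expressions are meaningful), and the functional $u\mapsto\frac12\int_{-1}^1(u-u^\delta)^2\,dx+TGV_{\lambda_1,\lambda_2}(u)$ on $L^2(-1,1)$ has exactly one minimizer, namely $$v^{(1)}_{\mu_1}+\frac{\mu_1}{\|u^\delta\|_{*,TV}}\,v^{(2)}_{\mu_2}.$$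 -/

import Mathlib

open MeasureTheory Set
open scoped NNReal ENNReal ContDiff

noncomputable section

namespace Denoising

/-- Lebesgue measure on the interval `(-1, 1)`. -/
abbrev vol : Measure ℝ := volume.restrict (Ioo (-1 : ℝ) 1)

/-- The Hilbert space `L²(-1, 1)`. -/
abbrev L2 : Type := Lp ℝ 2 vol

/-- `φ ∈ C_c^∞(-1, 1)`, the functions being extended by zero to the line. -/
def IsTest (φ : ℝ → ℝ) : Prop :=
  ContDiff ℝ ∞ φ ∧ HasCompactSupport φ ∧ tsupport φ ⊆ Ioo (-1 : ℝ) 1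

/-- `TV^i_α(u)`: supremum of `∫ u φ^(i)` over test functions `φ` with `‖φ‖_∞ ≤ α`. -/
def TV (i : ℕ) (α : ℝ≥0) (u : L2) : EReal :=
  ⨆ (φ : ℝ → ℝ) (_ : IsTest φ) (_ : ∀ x ∈ Ioo (-1 : ℝ) 1, |φ x| ≤ α),
    ((∫ x, u x * iteratedDeriv i φ x ∂vol : ℝ) : EReal)

/-- `TGV_{a,b}(u)`: supremum of `∫ u φ''` over test functions `φ` with `‖φ'‖_∞ ≤ a` and
`‖φ‖_∞ ≤ b`. -/
def TGV (a b : ℝ≥0) (u : L2) : EReal :=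
  ⨆ (φ : ℝ → ℝ) (_ : IsTest φ) (_ : ∀ x ∈ Ioo (-1 : ℝ) 1, |deriv φ x| ≤ a)
    (_ : ∀ x ∈ Ioo (-1 : ℝ) 1, |φ x| ≤ b),
    ((∫ x, u x * iteratedDeriv 2 φ x ∂vol : ℝ) : EReal)

/-- The denoising functional `u ↦ ½ ∫ (u - f)² + R(u)` with data `f` and regularizer `R`. -/
def functional (R : L2 → EReal) (f u : L2) : EReal :=
  ((1 / 2 * ∫ x, (u x - f x) ^ 2 ∂vol : ℝ) : EReal) + R u

/-- `u` is a (global) minimizer over `L²(-1, 1)` of the denoising functional. -/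
def IsMinimizer (R : L2 → EReal) (f u : L2) : Prop :=
  ∀ w : L2, functional R f u ≤ functional R f w

/-- The `*`-number of `g`: supremum of `∫ g u` over `u ∈ L²(-1, 1)` with `R(u) ≤ 1`. -/
def starNumber (R : L2 → EReal) (g : L2) : EReal :=
  ⨆ (u : L2) (_ : R u ≤ 1), ((∫ x, g x * u x ∂vol : ℝ) : EReal)

/-- The `*`-number `‖g‖_{*,TV}` of the total variation `TV = TV^1_1`. -/
def starTV (g : L2) : EReal := starNumber (TV 1 1) g

/-- The iterated primitives `σ^0[g] = g`, `σ^{i+1}[g](x) = ∫_{-1}^x σ^i[g]`. -/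
def sigma : ℕ → (ℝ → ℝ) → ℝ → ℝ
  | 0, g => g
  | i + 1, g => fun x => ∫ t in (-1 : ℝ)..x, sigma i g t

/-! Existence and uniqueness of the minimizers of the `L²-TV^i` functionals. -/

theorem integral_sq_eq (u f : L2) : ∫ x, (u x - f x) ^ 2 ∂vol = ‖u - f‖ ^ 2 := by
  rw [← real_inner_self_eq_norm_sq, L2.inner_def]
  refine integral_congr_ae ?_
  filter_upwards [Lp.coeFn_sub u f] with x hx
  simp only [hx, Pi.sub_apply, RCLike.inner_apply, conj_trivial]
  ring

theorem existsUnique_isMinimizer (R : L2 → EReal) (f : L2) (S : Set L2) (hS : Convex ℝ S)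
    (h0 : (0 : L2) ∈ S) (hR : ∀ u, R u = ⨆ p ∈ S, ((inner ℝ p u : ℝ) : EReal)) :
    ∃! v, IsMinimizer R f v := by
  obtain ⟨p, hp, hpmin⟩ := exists_norm_eq_iInf_of_complete_convex
    (K := closure S) ⟨0, subset_closure h0⟩ isClosed_closure.isComplete hS.closure f
  have hvar := (norm_eq_iInf_iff_real_inner_le_zero hS.closure hp).1 hpmin
  have hle : ∀ w, ((inner ℝ p w : ℝ) : EReal) ≤ R w := by
    intro w
    have hcl : IsClosed {q : L2 | ((inner ℝ q w : ℝ) : EReal) ≤ R w} :=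
      isClosed_le (continuous_coe_real_ereal.comp (by fun_prop)) continuous_const
    have : closure S ⊆ {q : L2 | ((inner ℝ q w : ℝ) : EReal) ≤ R w} := by
      refine closure_minimal (fun q hq => ?_) hcl
      rw [Set.mem_ofPred_eq, hR w]
      exact le_iSup₂_of_le q hq le_rfl
    exact this hp
  have heq : R (f - p) = ((inner ℝ p (f - p) : ℝ) : EReal) := by
    refine le_antisymm ?_ (hle _)
    rw [hR]
    refine iSup₂_le fun q hq => EReal.coe_le_coe_iff.2 ?_
    have h := hvar q (subset_closure hq)
    rw [inner_sub_right] at h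
    rw [real_inner_comm (f - p) q, real_inner_comm (f - p) p]
    linarith
  have key : ∀ w, functional R f (f - p) + ((1 / 2 * ‖w - (f - p)‖ ^ 2 : ℝ) : EReal)
      ≤ functional R f w := by
    intro w
    unfold functional
    rw [heq, integral_sq_eq, integral_sq_eq]
    refine le_trans ?_ (add_le_add_right (hle w) _)
    norm_cast
    have e : w - (f - p) = (w - f) + p := by abel
    have e' : f - p - f = -p := by abel
    rw [e, e', norm_add_sq_real, norm_neg, inner_sub_right, real_inner_self_eq_norm_sq,
      inner_sub_left, real_inner_comm p w, real_inner_comm p f]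
    linarith
  have hreal : ∃ r : ℝ, functional R f (f - p) = r := by
    refine ⟨1 / 2 * ∫ x, ((f - p : L2) x - f x) ^ 2 ∂vol + inner ℝ p (f - p), ?_⟩
    unfold functional
    rw [heq]
    norm_cast
  refine ⟨f - p, fun w => le_trans ?_ (key w), fun w hw => ?_⟩
  · refine le_add_of_nonneg_right ?_
    exact_mod_cast (by positivity : (0 : ℝ) ≤ 1 / 2 * ‖w - (f - p)‖ ^ 2)
  · obtain ⟨r, hr⟩ := hreal
    have h := (key w).trans (hw (f - p))
    rw [hr] at h
    have h' : r + 1 / 2 * ‖w - (f - p)‖ ^ 2 ≤ r := by exact_mod_cast h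
    have h2 : ‖w - (f - p)‖ ^ 2 = 0 := le_antisymm (by linarith) (by positivity)
    exact sub_eq_zero.1 (norm_eq_zero.1 (pow_eq_zero_iff two_ne_zero |>.1 h2))

theorem IsTest.memLp {φ : ℝ → ℝ} (hφ : IsTest φ) (i : ℕ) : MemLp (iteratedDeriv i φ) 2 vol := by
  have hc : Continuous (iteratedDeriv i φ) :=
    hφ.1.continuous_iteratedDeriv i (by exact_mod_cast le_top)
  have hs : HasCompactSupport (iteratedDeriv i φ) := by
    induction i with
    | zero => simpa using hφ.2.1
    | succ n ih =>
      rw [iteratedDeriv_succ]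
      exact (ih (hφ.1.continuous_iteratedDeriv n (by exact_mod_cast le_top))).deriv
  exact (hc.memLp_of_hasCompactSupport hs).restrict _

theorem existsUnique_isMinimizer_TV (i : ℕ) (α : ℝ≥0) (f : L2) :
    ∃! v, IsMinimizer (TV i α) f v := by
  refine existsUnique_isMinimizer _ f
    {p | ∃ φ, IsTest φ ∧ (∀ x ∈ Ioo (-1 : ℝ) 1, |φ x| ≤ α) ∧ p =ᵐ[vol] iteratedDeriv i φ}
    ?_ ?_ ?_
  · rintro p ⟨φ, hφ, hφα, hp⟩ q ⟨ψ, hψ, hψα, hq⟩ a b ha hb hab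
    have hsub : tsupport (fun x => a * φ x + b * ψ x) ⊆ tsupport φ ∪ tsupport ψ := by
      refine closure_minimal (fun x hx => ?_)
        ((isClosed_tsupport φ).union (isClosed_tsupport ψ))
      by_contra hcon
      simp only [mem_union, not_or] at hcon
      exact hx (by simp [image_eq_zero_of_notMem_tsupport hcon.1,
        image_eq_zero_of_notMem_tsupport hcon.2])
    refine ⟨fun x => a * φ x + b * ψ x, ⟨?_, ?_, ?_⟩, fun x hx => ?_, ?_⟩
    · exact (contDiff_const.mul hφ.1).add (contDiff_const.mul hψ.1)
    · exact IsCompact.of_isClosed_subset (hφ.2.1.isCompact.union hψ.2.1.isCompact)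
        (isClosed_tsupport _) hsub
    · exact hsub.trans (union_subset hφ.2.2 hψ.2.2)
    · calc |a * φ x + b * ψ x| ≤ |a * φ x| + |b * ψ x| := abs_add_le _ _
        _ = a * |φ x| + b * |ψ x| := by rw [abs_mul, abs_mul, abs_of_nonneg ha, abs_of_nonneg hb]
        _ ≤ a * α + b * α := by gcongr; exacts [hφα x hx, hψα x hx]
        _ = α := by rw [← add_mul, hab, one_mul]
    · filter_upwards [hp, hq, Lp.coeFn_add (a • p) (b • q), Lp.coeFn_smul a p,
        Lp.coeFn_smul b q] with x h1 h2 h3 h4 h5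
      have hφ' : ContDiffAt ℝ i φ x := (hφ.1.of_le (by exact_mod_cast le_top)).contDiffAt
      have hψ' : ContDiffAt ℝ i ψ x := (hψ.1.of_le (by exact_mod_cast le_top)).contDiffAt
      rw [iteratedDeriv_fun_add (contDiffAt_const.mul hφ') (contDiffAt_const.mul hψ'),
        iteratedDeriv_const_mul_field, iteratedDeriv_const_mul_field]
      simp only [h3, h4, h5, h1, h2, Pi.add_apply, Pi.smul_apply, smul_eq_mul]
  · refine ⟨0, ⟨contDiff_const, HasCompactSupport.zero, ?_⟩, by simp, ?_⟩
    · simp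
    · filter_upwards [Lp.coeFn_zero ℝ 2 vol] with x hx
      have : iteratedDeriv i (0 : ℝ → ℝ) x = 0 := by
        simp
      rw [hx, this]; rfl
  · intro u
    have hint : ∀ (φ : ℝ → ℝ) (p : L2), p =ᵐ[vol] iteratedDeriv i φ →
        ∫ x, u x * iteratedDeriv i φ x ∂vol = inner ℝ p u := by
      intro φ p hp
      rw [L2.inner_def]
      refine integral_congr_ae ?_
      filter_upwards [hp] with x hx
      simp [hx]
    refine le_antisymm ?_ ?_
    · refine iSup_le fun φ => iSup₂_le fun hφ hα => ?_
      have hp := (hφ.memLp i).coeFn_toLp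
      rw [hint φ _ hp]
      exact le_iSup₂_of_le ((hφ.memLp i).toLp _) ⟨φ, hφ, hα, hp⟩ le_rfl
    · refine iSup₂_le ?_
      rintro p ⟨φ, hφ, hα, hp⟩
      rw [← hint φ p hp]
      exact le_iSup_of_le φ (le_iSup₂_of_le hφ hα le_rfl)

/-- The unique minimizer of `u ↦ ½ ∫ (u - f)² + TV^i_α(u)`. -/
def tvMin (i : ℕ) (α : ℝ≥0) (f : L2) : L2 := (existsUnique_isMinimizer_TV i α f).choose

/-- The set `Λ` of parameters (for data `f`): `λ₁ < ‖σ¹[v - f]‖_∞` for the `TV²_{λ₂}`-minimizer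
`v`, and `λ₂ < ‖σ²[v - f]‖_∞` for the `TV¹_{λ₁}`-minimizer `v`. -/
def Lam (f : L2) : Set (ℝ≥0 × ℝ≥0) :=
  {l | (l.1 : ℝ≥0∞) < eLpNorm (sigma 1 ⇑(tvMin 2 l.2 f - f)) ∞ vol ∧
       (l.2 : ℝ≥0∞) < eLpNorm (sigma 2 ⇑(tvMin 1 l.1 f - f)) ∞ vol}

/-- The function `1_{[-1/2, 1/2]} - 1/2`. -/
def boxFun (x : ℝ) : ℝ := (Icc (-1 / 2 : ℝ) (1 / 2)).indicator (fun _ => (1 : ℝ)) x - 1 / 2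

theorem boxFun_memLp : MemLp boxFun 2 vol :=
  ((memLp_const (1 : ℝ)).indicator measurableSet_Icc).sub (memLp_const (1 / 2 : ℝ))

/-- The data `u^δ = 1_{[-1/2, 1/2]} - 1/2` as an element of `L²(-1, 1)`. -/
def uData : L2 := boxFun_memLp.toLp boxFun

end Denoising

end

namespace Denoising

/-! ### Primitives -/

/-! Each regularizer is the support function of a set of derivatives of test functions, so its
denoising minimizer is the data `uData` minus the projection of `uData` onto the closure of that set
(`isMinimizer_iff`). Let `p` be the projection of `uData` onto `feas μ₂`, so that `tvMin 2 μ₂ uData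
= uData - p`. The claim becomes that `4μ₁ • p` is the projection for `TGV l₁ l₂`; the factor 4 comes
from `starTV uData = 1/4`.

The decisive fact is that the primitive of `p` attains its largest modulus at the jumps `±1/2` of
the data, where that modulus is `½⟨uData, p⟩` (`abs_prim1_le_of_projection`). Hence `starTV (-p) =
½⟨uData, p⟩` and `l₁ = 2μ₁⟨uData, p⟩`, so `4μ₁ • p` meets both TGV bounds. For optimality write
`uData - 4μ₁p = (1 - 4μ₁) uData + 4μ₁ (uData - p)`. Against an admissible `q = φ''`, the first term
is controlled by `⟨uData, q⟩ = φ'(1/2) - φ'(-1/2) ≤ 2l₁ = ⟨uData, 4μ₁p⟩`, the second by the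
projection inequality for `p`. This needs `μ₁ ≤ 1/4`. If that failed, the sublinear growth of
`⟨uData, ·⟩` in the size of the feasible set (`IsProj.inner_uData_le`) would bound the primitive of
the projection onto `feas l₂` by `l₁`, contradicting membership in `Λ`.

To locate the maximum, symmetry makes `p` even, and its left half solves a variational problem on
`[-1, 0]` (`IsHalfMin`). If the primitive there exceeded its modulus at `-1/2`, a competitor would
do better: excursions beyond a level are cut off, and the part left of the last zero before `-1/2`
is translated, with a suitable sign, so that a larger value lands on `-1/2`. -/

theorem sigma_one_apply (h : ℝ → ℝ) (x : ℝ) : sigma 1 h x = ∫ t in (-1 : ℝ)..x, h t := rfl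

theorem sigma_two_apply (h : ℝ → ℝ) (x : ℝ) : sigma 2 h x = ∫ t in (-1 : ℝ)..x, sigma 1 h t := rfl

theorem sigma_one_neg_one (h : ℝ → ℝ) : sigma 1 h (-1) = 0 := by
  rw [sigma_one_apply, intervalIntegral.integral_same]

theorem intervalIntegrable_of_memLp {h : ℝ → ℝ} (hh : MemLp h 2 volume) (a b : ℝ) :
    IntervalIntegrable h volume a b :=
  ((hh.locallyIntegrable one_le_two).integrableOn_isCompact isCompact_uIcc).intervalIntegrable

theorem continuous_sigma_one {h : ℝ → ℝ} (hh : ∀ a b, IntervalIntegrable h volume a b) :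
    Continuous (sigma 1 h) :=
  intervalIntegral.continuous_primitive hh _

theorem sigma_one_sub {h : ℝ → ℝ} (hh : ∀ a b, IntervalIntegrable h volume a b) (x y : ℝ) :
    sigma 1 h y - sigma 1 h x = ∫ t in x..y, h t :=
  intervalIntegral.integral_interval_sub_left (hh _ _) (hh _ _)

theorem sigma_two_sub {h : ℝ → ℝ} (hh : ∀ a b, IntervalIntegrable h volume a b) (x y : ℝ) :
    sigma 2 h y - sigma 2 h x = ∫ t in x..y, sigma 1 h t :=
  intervalIntegral.integral_interval_sub_left ((continuous_sigma_one hh).intervalIntegrable _ _)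
    ((continuous_sigma_one hh).intervalIntegrable _ _)

/-- Cutting out an interval with equal end values of the primitive makes the primitive constant
there, and does not change it elsewhere. -/
theorem sigma_one_cut {h : ℝ → ℝ} (hh : MemLp h 2 volume) {α β : ℝ} (hα : -1 ≤ α) (hαβ : α ≤ β)
    (he : sigma 1 h α = sigma 1 h β) :
    (∀ x ≤ α, sigma 1 ((Ioc α β)ᶜ.indicator h) x = sigma 1 h x) ∧
    (∀ x ∈ Icc α β, sigma 1 ((Ioc α β)ᶜ.indicator h) x = sigma 1 h α) ∧
    (∀ x, β ≤ x → sigma 1 ((Ioc α β)ᶜ.indicator h) x = sigma 1 h x) := by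
  have hk : MemLp ((Ioc α β)ᶜ.indicator h) 2 volume := hh.indicator measurableSet_Ioc.compl
  have hi := intervalIntegrable_of_memLp hh
  have ki := intervalIntegrable_of_memLp hk
  have h1 : ∀ x ≤ α, sigma 1 ((Ioc α β)ᶜ.indicator h) x = sigma 1 h x := by
    intro x hx
    refine intervalIntegral.integral_congr_ae (.of_forall fun t ht => ?_)
    have : t ≤ α := ht.2.trans (sup_le hα hx)
    exact indicator_of_mem (fun h' => absurd h'.1 (not_lt.2 this)) _
  have h2 : ∀ x ∈ Icc α β, sigma 1 ((Ioc α β)ᶜ.indicator h) x = sigma 1 h α := by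
    intro x hx
    rw [← h1 α le_rfl, ← sub_eq_zero, sigma_one_sub ki]
    rw [← intervalIntegral.integral_zero (a := α) (b := x) (μ := volume)]
    refine intervalIntegral.integral_congr_ae (.of_forall fun t ht => ?_)
    rw [uIoc_of_le hx.1] at ht
    exact indicator_of_notMem (notMem_compl_iff.2 (show t ∈ Ioc α β from ⟨ht.1, ht.2.trans hx.2⟩)) _
  refine ⟨h1, h2, fun x hx => ?_⟩
  have h3 := sigma_one_sub ki β x
  have h4 := sigma_one_sub hi β x
  have h5 := h2 β (right_mem_Icc.2 hαβ)
  have : ∫ t in β..x, (Ioc α β)ᶜ.indicator h t = ∫ t in β..x, h t := by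
    refine intervalIntegral.integral_congr_ae (.of_forall fun t ht => ?_)
    rw [uIoc_of_le hx] at ht
    exact indicator_of_mem (fun h' => absurd h'.2 (not_le.2 ht.1)) _
  linarith

/-- The greatest point of the compact set where `c ≤ G` works: the intermediate value theorem forces
equality there. These crossings supply the endpoints of the cuts below. -/
theorem exists_last_crossing {G : ℝ → ℝ} (hG : Continuous G) {a m c : ℝ} (ham : a ≤ m)
    (ha : c ≤ G a) (hm : G m ≤ c) : ∃ α ∈ Icc a m, G α = c ∧ ∀ x ∈ Icc α m, G x ≤ c := by
  obtain ⟨α, ⟨hα, hαc⟩, hmax⟩ := (isCompact_Icc.inter_right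
    (isClosed_le continuous_const hG) : IsCompact (Icc a m ∩ {x | c ≤ G x})).exists_isGreatest
      ⟨a, left_mem_Icc.2 ham, ha⟩
  obtain ⟨y, hy, hyc⟩ := intermediate_value_Icc' hα.2 hG.continuousOn ⟨hm, hαc⟩
  have hyα : y = α := le_antisymm (hmax ⟨⟨hα.1.trans hy.1, hy.2⟩, hyc.ge⟩) hy.1
  refine ⟨α, hα, hyα ▸ hyc, fun x hx => ?_⟩
  by_contra! hcon
  have : x = α := le_antisymm (hmax ⟨⟨hα.1.trans hx.1, hx.2⟩, hcon.le⟩) hx.1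
  rw [this, ← hyα, hyc] at hcon
  exact lt_irrefl _ hcon

theorem exists_first_crossing {G : ℝ → ℝ} (hG : Continuous G) {a m c : ℝ} (hma : m ≤ a)
    (ha : c ≤ G a) (hm : G m ≤ c) : ∃ β ∈ Icc m a, G β = c ∧ ∀ x ∈ Icc m β, G x ≤ c := by
  obtain ⟨α, hα, h1, h2⟩ := exists_last_crossing (G := fun x => G (-x)) (by fun_prop)
    (neg_le_neg hma) (c := c) (by simpa using ha) (by simpa using hm)
  refine ⟨-α, ⟨by linarith [hα.2], by linarith [hα.1]⟩, h1, fun x hx => ?_⟩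
  simpa using h2 (-x) ⟨by linarith [hx.2], by linarith [hx.1]⟩

/-! ### The problem on half of the interval -/

/-- `h` minimizes `½ ∫ k² + σ¹[k](-1/2)` among the `k` with `σ¹[k](0) = 0` and `|σ²[k]| ≤ μ`
on `[-1, 0]`. -/
structure IsHalfMin (μ : ℝ) (h : ℝ → ℝ) : Prop where
  memLp : MemLp h 2 volume
  zero : sigma 1 h 0 = 0
  bound : ∀ x ∈ Icc (-1 : ℝ) 0, |sigma 2 h x| ≤ μ
  opt : ∀ k : ℝ → ℝ, MemLp k 2 volume → sigma 1 k 0 = 0 →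
    (∀ x ∈ Icc (-1 : ℝ) 0, |sigma 2 k x| ≤ μ) →
    1 / 2 * (∫ x, h x ^ 2) + sigma 1 h (-1 / 2) ≤ 1 / 2 * (∫ x, k x ^ 2) + sigma 1 k (-1 / 2)

theorem integral_indicator_sq (h : ℝ → ℝ) {s : Set ℝ} (hs : MeasurableSet s) :
    ∫ x, s.indicator h x ^ 2 = ∫ x in s, h x ^ 2 := by
  rw [← integral_indicator hs]
  congr 1 with x
  by_cases hx : x ∈ s <;> simp [hx]

namespace IsHalfMin

variable {μ : ℝ} {h : ℝ → ℝ}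

theorem continuous_sigma (H : IsHalfMin μ h) : Continuous (sigma 1 h) :=
  continuous_sigma_one (intervalIntegrable_of_memLp H.memLp)

/-- The cut keeps the linear term and lowers the energy by half of `∫ h²` over the removed interval.
Minimality makes that integral vanish, so `h` is zero almost everywhere there. -/
theorem sigma_eq_of_cut (H : IsHalfMin μ h) {α β : ℝ} (hα : -1 ≤ α) (hαβ : α ≤ β) (hβ : β ≤ 0)
    (he : sigma 1 h α = sigma 1 h β)
    (hk : sigma 1 ((Ioc α β)ᶜ.indicator h) (-1 / 2) = sigma 1 h (-1 / 2))
    (hb : ∀ x ∈ Icc (-1 : ℝ) 0, |sigma 2 ((Ioc α β)ᶜ.indicator h) x| ≤ μ) :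
    ∀ x ∈ Icc α β, sigma 1 h x = sigma 1 h α := by
  have hint : Integrable (fun x => h x ^ 2) := H.memLp.integrable_sq
  have h1 := H.opt _ (H.memLp.indicator measurableSet_Ioc.compl)
    (((sigma_one_cut H.memLp hα hαβ he).2.2 0 hβ).trans H.zero) hb
  rw [hk, integral_indicator_sq _ measurableSet_Ioc.compl,
    ← integral_add_compl (measurableSet_Ioc (a := α) (b := β)) hint] at h1
  have h2 : ∫ x in Ioc α β, h x ^ 2 = 0 :=
    le_antisymm (by linarith) (integral_nonneg fun x => sq_nonneg _)
  rw [integral_eq_zero_iff_of_nonneg (fun x => sq_nonneg _) hint.integrableOn] at h2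
  intro x hx
  rw [← sub_eq_zero, sigma_one_sub (intervalIntegrable_of_memLp H.memLp),
    intervalIntegral.integral_of_le hx.1]
  have h3 : ∀ᵐ t ∂volume.restrict (Ioc α x), h t = 0 := by
    refine Filter.Eventually.filter_mono (ae_mono (Measure.restrict_mono
      (Ioc_subset_Ioc_right hx.2) le_rfl)) ?_
    filter_upwards [h2] with t ht
    exact pow_eq_zero_iff two_ne_zero |>.1 ht
  rw [integral_congr_ae h3, integral_zero]

theorem mu_nonneg (H : IsHalfMin μ h) : 0 ≤ μ :=
  (abs_nonneg _).trans (H.bound 0 ⟨by norm_num, le_rfl⟩)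

theorem sigma_neg_half_nonpos (H : IsHalfMin μ h) : sigma 1 h (-1 / 2) ≤ 0 := by
  have h1 := H.opt 0 MemLp.zero (by simp [sigma_one_apply])
    (by simpa [sigma_two_apply, sigma_one_apply] using fun _ _ _ => H.mu_nonneg)
  have h2 : 0 ≤ ∫ x, h x ^ 2 := integral_nonneg fun x => sq_nonneg _
  simp [sigma_one_apply] at h1 ⊢
  linarith

/-- After its first zero to the right of `-1/2`, the primitive may be replaced by zero up to the
origin. The second primitive is then frozen at an admissible value, so by minimality nothing was
there to remove. -/
theorem sigma_nonpos_right (H : IsHalfMin μ h) :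
    ∀ x ∈ Icc (-1 / 2 : ℝ) 0, sigma 1 h x ≤ 0 := by
  obtain ⟨θ, hθ, h0, hle⟩ := exists_first_crossing H.continuous_sigma
    (by norm_num : (-1 / 2 : ℝ) ≤ 0) H.zero.ge H.sigma_neg_half_nonpos
  have hθ1 : -1 ≤ θ := by linarith [hθ.1]
  have he : sigma 1 h θ = sigma 1 h 0 := h0.trans H.zero.symm
  obtain ⟨c1, c2, c3⟩ := sigma_one_cut H.memLp hθ1 hθ.2 he
  have ki := intervalIntegrable_of_memLp (H.memLp.indicator (s := (Ioc θ 0)ᶜ)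
    measurableSet_Ioc.compl)
  have hΦ : ∀ x ∈ Icc (-1) θ, sigma 2 ((Ioc θ 0)ᶜ.indicator h) x = sigma 2 h x := by
    intro x hx
    refine intervalIntegral.integral_congr fun t ht => c1 t ?_
    rw [uIcc_of_le hx.1] at ht
    exact ht.2.trans hx.2
  have key := H.sigma_eq_of_cut hθ1 hθ.2 le_rfl he (c1 _ hθ.1) (fun x hx => by
    rcases le_total x θ with hxθ | hxθ
    · rw [hΦ x ⟨hx.1, hxθ⟩]
      exact H.bound x hx
    · have h3 := sigma_two_sub ki θ x
      have h4 : ∫ t in θ..x, sigma 1 ((Ioc θ 0)ᶜ.indicator h) t = 0 := by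
        rw [intervalIntegral.integral_congr (g := fun _ => 0),
          intervalIntegral.integral_zero]
        intro t ht
        rw [uIcc_of_le hxθ] at ht
        exact (c2 t ⟨ht.1, ht.2.trans hx.2⟩).trans h0
      rw [h4, hΦ θ ⟨hθ1, le_rfl⟩, sub_eq_zero] at h3
      rw [h3]
      exact H.bound θ ⟨hθ1, hθ.2⟩)
  intro x hx
  rcases le_total x θ with hxθ | hxθ
  · exact hle x ⟨hx.1, hxθ⟩
  · rw [key x ⟨hxθ, hx.2⟩, h0]

/-- A dip of the primitive below its value `c` at `-1/2` can be filled up to the level `c` without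
changing the value at `-1/2`; minimality rules out such a dip. -/
theorem le_sigma_of_nonpos (H : IsHalfMin μ h) {θ : ℝ} (hθ : θ ∈ Icc (-1 : ℝ) (-1 / 2))
    (h0 : sigma 1 h θ = 0) (hle : ∀ x ∈ Icc θ 0, sigma 1 h x ≤ 0) :
    ∀ x ∈ Icc θ 0, sigma 1 h (-1 / 2) ≤ sigma 1 h x := by
  intro m hm
  by_contra! hcon
  have hc := H.sigma_neg_half_nonpos
  set c := sigma 1 h (-1 / 2) with hcdef
  obtain ⟨α, hα, hαc, hα'⟩ := exists_last_crossing H.continuous_sigma hm.1 (c := c)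
    (hc.trans h0.ge) hcon.le
  obtain ⟨β, hβ, hβc, hβ'⟩ := exists_first_crossing H.continuous_sigma hm.2 (c := c)
    (hc.trans H.zero.ge) hcon.le
  have hα1 : -1 ≤ α := hθ.1.trans hα.1
  have hαβ : α ≤ β := hα.2.trans hβ.1
  have he : sigma 1 h α = sigma 1 h β := hαc.trans hβc.symm
  obtain ⟨c1, c2, c3⟩ := sigma_one_cut H.memLp hα1 hαβ he
  have ki := intervalIntegrable_of_memLp (H.memLp.indicator (s := (Ioc α β)ᶜ)
    measurableSet_Ioc.compl)
  have hi := intervalIntegrable_of_memLp H.memLp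
  set k := (Ioc α β)ᶜ.indicator h with hkdef
  have hge : ∀ x, sigma 1 h x ≤ sigma 1 k x := by
    intro x
    rcases le_total x α with h1 | h1
    · exact (c1 x h1).ge
    rcases le_total β x with h2 | h2
    · exact (c3 x h2).ge
    rw [c2 x ⟨h1, h2⟩, hαc]
    rcases le_total x m with h3 | h3
    exacts [hα' x ⟨h1, h3⟩, hβ' x ⟨h3, h2⟩]
  have hkle : ∀ x ∈ Icc θ 0, sigma 1 k x ≤ 0 := by
    intro x hx
    rcases le_total x α with h1 | h1
    · exact (c1 x h1).trans_le (hle x hx)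
    rcases le_total β x with h2 | h2
    · exact (c3 x h2).trans_le (hle x hx)
    rw [c2 x ⟨h1, h2⟩, hαc]
    exact hc
  have hhalf : sigma 1 k (-1 / 2) = sigma 1 h (-1 / 2) := by
    rcases le_total (-1 / 2) α with h1 | h1
    · exact c1 _ h1
    rcases le_total β (-1 / 2) with h2 | h2
    · exact c3 _ h2
    rw [c2 _ ⟨h1, h2⟩, hαc]
  have hΦ : ∀ x ∈ Icc (-1) θ, sigma 2 k x = sigma 2 h x := by
    intro x hx
    refine intervalIntegral.integral_congr fun t ht => c1 t ?_
    rw [uIcc_of_le hx.1] at ht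
    exact (ht.2.trans hx.2).trans hα.1
  have key := H.sigma_eq_of_cut hα1 hαβ hβ.2 he hhalf (fun x hx => by
    rcases le_total x θ with hxθ | hxθ
    · rw [hΦ x ⟨hx.1, hxθ⟩]
      exact H.bound x hx
    -- Filling the dip only raises the second primitive, which keeps the lower bound. The filled
    -- primitive is still nonpositive after `θ`, so the value at `θ` gives the upper bound.
    refine abs_le.2 ⟨(abs_le.1 (H.bound x hx)).1.trans ?_, ?_⟩
    · exact intervalIntegral.integral_mono_on hx.1 ((continuous_sigma_one hi).intervalIntegrable _ _)
        ((continuous_sigma_one ki).intervalIntegrable _ _) fun t _ => hge t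
    · have h3 := sigma_two_sub ki θ x
      have h4 : 0 ≤ ∫ t in θ..x, -sigma 1 k t :=
        intervalIntegral.integral_nonneg hxθ fun t ht =>
          neg_nonneg.2 (hkle t ⟨ht.1, ht.2.trans hx.2⟩)
      rw [intervalIntegral.integral_neg] at h4
      have h5 := hΦ θ ⟨hθ.1, le_rfl⟩
      have h6 := (abs_le.1 (H.bound θ ⟨hθ.1, hxθ.trans hx.2⟩)).2
      linarith)
  have := key m ⟨hα.2, hβ.1⟩
  rw [hαc] at this
  exact hcon.ne this

/-- The part of the minimizer to the left of a zero of its primitive has small primitive: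
otherwise its translate would be a better competitor. -/
theorem abs_sigma_le_left (H : IsHalfMin μ h) {θ : ℝ} (hθ : θ ∈ Icc (-1 : ℝ) (-1 / 2))
    (h0 : sigma 1 h θ = 0) (m : ℝ) (hm : m ∈ Icc (-1) θ) (ε : ℝ) (hε : ε = 1 ∨ ε = -1) :
    -ε * sigma 1 h m ≤ -sigma 1 h (-1 / 2) := by
  have hε2 : ε ^ 2 = 1 := by rcases hε with rfl | rfl <;> norm_num
  have hεabs : |ε| = 1 := by rcases hε with rfl | rfl <;> norm_num
  set g := (Ioc (-1) θ).indicator h with hg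
  have gm : MemLp g 2 volume := H.memLp.indicator measurableSet_Ioc
  have gi := intervalIntegrable_of_memLp gm
  have hi := intervalIntegrable_of_memLp H.memLp
  have g1 : ∀ x ≤ -1, sigma 1 g x = 0 := by
    intro x hx
    rw [sigma_one_apply, ← intervalIntegral.integral_zero (a := -1) (b := x) (μ := volume)]
    refine intervalIntegral.integral_congr_ae (.of_forall fun t ht => ?_)
    rw [uIoc_of_ge hx] at ht
    exact indicator_of_notMem (fun h' => absurd h'.1 (not_lt.2 ht.2)) _
  have g2 : ∀ x ∈ Icc (-1) θ, sigma 1 g x = sigma 1 h x := by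
    intro x hx
    refine intervalIntegral.integral_congr_ae (.of_forall fun t ht => ?_)
    rw [uIoc_of_le hx.1] at ht
    exact indicator_of_mem (show t ∈ Ioc (-1) θ from ⟨ht.1, ht.2.trans hx.2⟩) _
  have g3 : ∀ x, θ ≤ x → sigma 1 g x = 0 := by
    intro x hx
    have h1 := sigma_one_sub gi θ x
    have h2 : ∫ t in θ..x, g t = 0 := by
      rw [← intervalIntegral.integral_zero (a := θ) (b := x) (μ := volume)]
      refine intervalIntegral.integral_congr_ae (.of_forall fun t ht => ?_)
      rw [uIoc_of_le hx] at ht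
      exact indicator_of_notMem (fun h' => absurd h'.2 (not_le.2 ht.1)) _
    rw [h2, g2 θ ⟨hθ.1, le_rfl⟩, h0] at h1
    linarith
  have p1 : ∀ x ≤ -1, sigma 2 g x = 0 := by
    intro x hx
    rw [sigma_two_apply, ← intervalIntegral.integral_zero (a := -1) (b := x) (μ := volume)]
    refine intervalIntegral.integral_congr fun t ht => ?_
    rw [uIcc_of_ge hx] at ht
    exact g1 t ht.2
  have p2 : ∀ x ∈ Icc (-1) θ, sigma 2 g x = sigma 2 h x := by
    intro x hx
    refine intervalIntegral.integral_congr fun t ht => ?_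
    rw [uIcc_of_le hx.1] at ht
    exact g2 t ⟨ht.1, ht.2.trans hx.2⟩
  have p3 : ∀ x, θ ≤ x → sigma 2 g x = sigma 2 h θ := by
    intro x hx
    have h1 := sigma_two_sub gi θ x
    have h2 : ∫ t in θ..x, sigma 1 g t = 0 := by
      rw [← intervalIntegral.integral_zero (a := θ) (b := x) (μ := volume)]
      refine intervalIntegral.integral_congr fun t ht => ?_
      rw [uIcc_of_le hx] at ht
      exact g3 t ht.1
    rw [h2, p2 θ ⟨hθ.1, le_rfl⟩] at h1
    linarith
  have pb : ∀ x, |sigma 2 g x| ≤ μ := by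
    intro x
    rcases le_total x (-1) with h1 | h1
    · rw [p1 x h1, abs_zero]; exact H.mu_nonneg
    rcases le_total x θ with h2 | h2
    · rw [p2 x ⟨h1, h2⟩]; exact H.bound x ⟨h1, by linarith [hθ.2]⟩
    · rw [p3 x h2]; exact H.bound θ ⟨hθ.1, by linarith [hθ.2]⟩
  -- The shift that carries the point `m` to `-1/2`. It moves `g` to the right, and since `d ≥ -1/2
  -- ≥ θ` the translated primitive still vanishes at `0`.
  set d := m + 1 / 2 with hd
  have hd0 : d ≤ 0 := by linarith [hm.2, hθ.2]
  have s1 : ∀ x, sigma 1 (fun s => ε * g (s + d)) x = ε * sigma 1 g (x + d) := by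
    intro x
    rw [sigma_one_apply, intervalIntegral.integral_const_mul,
      intervalIntegral.integral_comp_add_right g d, ← sigma_one_sub gi, g1 (-1 + d) (by linarith),
      sub_zero]
  have s2 : ∀ x, sigma 2 (fun s => ε * g (s + d)) x = ε * sigma 2 g (x + d) := by
    intro x
    rw [sigma_two_apply]
    simp only [s1]
    rw [intervalIntegral.integral_const_mul,
      intervalIntegral.integral_comp_add_right (sigma 1 g) d, ← sigma_two_sub gi,
      p1 (-1 + d) (by linarith), sub_zero]
  have hopt := H.opt (fun s => ε * g (s + d))
    ((gm.comp_measurePreserving (measurePreserving_add_right volume d)).const_mul ε)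
    (by rw [s1, g3 _ (by rw [hd]; linarith [hm.1, hθ.2]), mul_zero])
    (fun x _ => by rw [s2, abs_mul, hεabs, one_mul]; exact pb _)
  have e1 : ∫ x, (ε * g (x + d)) ^ 2 = ∫ x, g x ^ 2 := by
    simp only [mul_pow, hε2, one_mul]
    exact integral_add_right_eq_self (fun x => g x ^ 2) d
  have e2 : ∫ x, g x ^ 2 ≤ ∫ x, h x ^ 2 := by
    rw [hg, integral_indicator_sq _ measurableSet_Ioc]
    exact setIntegral_le_integral H.memLp.integrable_sq (.of_forall fun x => sq_nonneg _)
  rw [e1, s1, show (-1 / 2 : ℝ) + d = m by rw [hd]; ring, g2 m hm] at hopt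
  linarith

/-- The last zero `θ` before `-1/2` separates the two mechanisms: translation to its left, cutting
to its right. -/
theorem abs_sigma_le (H : IsHalfMin μ h) :
    ∀ x ∈ Icc (-1 : ℝ) 0, |sigma 1 h x| ≤ -sigma 1 h (-1 / 2) := by
  obtain ⟨θ, hθ, h0, hle⟩ := exists_last_crossing H.continuous_sigma
    (by norm_num : (-1 : ℝ) ≤ -1 / 2) (sigma_one_neg_one h).ge H.sigma_neg_half_nonpos
  have hle' : ∀ x ∈ Icc θ 0, sigma 1 h x ≤ 0 := fun x hx =>
    (le_total x (-1 / 2)).elim (fun h1 => hle x ⟨hx.1, h1⟩)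
      fun h1 => H.sigma_nonpos_right x ⟨h1, hx.2⟩
  intro x hx
  rcases le_total x θ with h1 | h1
  · have a := H.abs_sigma_le_left hθ h0 x ⟨hx.1, h1⟩ 1 (.inl rfl)
    have b := H.abs_sigma_le_left hθ h0 x ⟨hx.1, h1⟩ (-1) (.inr rfl)
    exact abs_le.2 ⟨by linarith, by linarith⟩
  · have a := H.le_sigma_of_nonpos hθ h0 hle' x ⟨h1, hx.2⟩
    have b := hle' x ⟨h1, hx.2⟩
    have c := H.sigma_neg_half_nonpos
    exact abs_le.2 ⟨by linarith, by linarith⟩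

end IsHalfMin

/-! ### Primitives of elements of `L²(-1, 1)` as continuous linear functionals -/

/-- Extension by zero to the line. -/
noncomputable def zext (p : ℝ → ℝ) : ℝ → ℝ := (Ioo (-1 : ℝ) 1).indicator p

theorem zext_congr {p q : ℝ → ℝ} (h : p =ᵐ[vol] q) : zext p =ᵐ[volume] zext q := by
  rw [Filter.EventuallyEq, ae_restrict_iff' measurableSet_Ioo] at h
  filter_upwards [h] with x hx
  by_cases hx' : x ∈ Ioo (-1 : ℝ) 1
  · simp [zext, hx', hx hx']
  · simp [zext, hx']

theorem memLp_zext (p : L2) : MemLp (zext p) 2 volume :=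
  (memLp_indicator_iff_restrict measurableSet_Ioo).2 (Lp.memLp p)

theorem sigma_one_congr {p q : ℝ → ℝ} (h : p =ᵐ[volume] q) (x : ℝ) : sigma 1 p x = sigma 1 q x :=
  intervalIntegral.integral_congr_ae (h.mono fun _ hx _ => hx)

theorem sigma_one_zext (p : ℝ → ℝ) {x : ℝ} (hx : x ∈ Icc (-1 : ℝ) 1) :
    sigma 1 (zext p) x = sigma 1 p x := by
  refine intervalIntegral.integral_congr_ae ?_
  have : ∀ᵐ t ∂(volume : Measure ℝ), t ≠ 1 := by simp [ae_iff]
  filter_upwards [this] with t ht1 ht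
  rw [uIoc_of_le hx.1] at ht
  exact indicator_of_mem (show t ∈ Ioo (-1 : ℝ) 1 from
    ⟨ht.1, lt_of_le_of_ne (ht.2.trans hx.2) ht1⟩) _

/-- The indicator function of `(-1, x]`. -/
noncomputable def step (x : ℝ) : L2 :=
  indicatorConstLp 2 (measurableSet_Ioc : MeasurableSet (Ioc (-1 : ℝ) x)) (measure_ne_top _ _) 1

theorem norm_step_le (x : ℝ) : ‖step x‖ ≤ 2 := by
  refine norm_indicatorConstLp_le.trans ?_
  have h1 : vol.real (Ioc (-1 : ℝ) x) ≤ 2 := by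
    refine (measureReal_mono (subset_univ _)).trans ?_
    simp only [Measure.real, Measure.restrict_apply_univ, Real.volume_Ioo]
    norm_num
  have h2 : vol.real (Ioc (-1 : ℝ) x) ^ (1 / (2 : ℝ≥0∞).toReal) ≤ 2 ^ (1 / (2 : ℝ≥0∞).toReal) :=
    Real.rpow_le_rpow measureReal_nonneg h1 (by simp)
  have h3 : (2 : ℝ) ^ (1 / (2 : ℝ≥0∞).toReal) ≤ 2 ^ (1 : ℝ) :=
    Real.rpow_le_rpow_of_exponent_le (by norm_num) (by norm_num)
  simp at h2 h3 ⊢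
  linarith

/-- The functional `p ↦ ∫_{-1}^x p`. -/
noncomputable def prim1 (x : ℝ) : L2 →L[ℝ] ℝ := innerSL ℝ (step x)

theorem prim1_eq_inner (x : ℝ) (p : L2) : prim1 x p = inner ℝ (step x) p := rfl

theorem prim1_apply (x : ℝ) (p : L2) : prim1 x p = sigma 1 (zext p) x := by
  rw [prim1_eq_inner, step, L2.inner_indicatorConstLp_one, sigma_one_apply]
  rcases le_total (-1) x with hx | hx
  · rw [intervalIntegral.integral_of_le hx, zext, setIntegral_indicator measurableSet_Ioo,
      Measure.restrict_restrict measurableSet_Ioc]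
  · rw [Ioc_eq_empty (not_lt.2 hx), Measure.restrict_empty, integral_zero_measure,
      intervalIntegral.integral_of_ge hx, zext, setIntegral_indicator measurableSet_Ioo]
    have : Ioc x (-1) ∩ Ioo (-1 : ℝ) 1 = ∅ := by
      ext t
      simp only [mem_inter_iff, mem_Ioc, mem_Ioo, mem_empty_iff_false, iff_false]
      rintro ⟨⟨_, h1⟩, h2, _⟩
      linarith
    rw [this]
    simp

theorem prim1_eq_sigma (p : L2) {x : ℝ} (hx : x ∈ Icc (-1 : ℝ) 1) : prim1 x p = sigma 1 p x := by
  rw [prim1_apply, sigma_one_zext _ hx]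

theorem continuous_prim1 (p : L2) : Continuous fun x => prim1 x p := by
  simp only [prim1_apply]
  exact continuous_sigma_one (intervalIntegrable_of_memLp (memLp_zext p))

theorem abs_prim1_le (x : ℝ) (p : L2) : |prim1 x p| ≤ 2 * ‖p‖ :=
  (abs_real_inner_le_norm _ _).trans
    (mul_le_mul_of_nonneg_right (norm_step_le x) (norm_nonneg p))

theorem prim1_neg_one (p : L2) : prim1 (-1) p = 0 := by
  rw [prim1_apply, sigma_one_neg_one]

/-- The functional `p ↦ ∫_{-1}^x ∫_{-1}^t p`. -/
noncomputable def prim2 (x : ℝ) : L2 →L[ℝ] ℝ :=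
  LinearMap.mkContinuous
    { toFun := fun p => ∫ t in (-1 : ℝ)..x, prim1 t p
      map_add' := fun p q => by
        simp only [map_add]
        exact intervalIntegral.integral_add ((continuous_prim1 p).intervalIntegrable _ _)
          ((continuous_prim1 q).intervalIntegrable _ _)
      map_smul' := fun c p => by
        simp only [map_smul, smul_eq_mul, RingHom.id_apply]
        exact intervalIntegral.integral_const_mul _ _ }
    (2 * |x - -1|)
    (fun p => by
      refine (intervalIntegral.norm_integral_le_of_norm_le_const
        (C := 2 * ‖p‖) fun t _ => abs_prim1_le t p).trans_eq ?_
      ring)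

theorem prim2_eq_integral (x : ℝ) (p : L2) : prim2 x p = ∫ t in (-1 : ℝ)..x, prim1 t p := rfl

theorem prim2_sub_prim2 (x y : ℝ) (p : L2) : prim2 y p - prim2 x p = ∫ t in x..y, prim1 t p :=
  intervalIntegral.integral_interval_sub_left ((continuous_prim1 p).intervalIntegrable _ _)
    ((continuous_prim1 p).intervalIntegrable _ _)

theorem abs_prim2_le {x : ℝ} (hx : x ∈ Icc (-1 : ℝ) 1) (p : L2) : |prim2 x p| ≤ 4 * ‖p‖ := by
  refine (intervalIntegral.norm_integral_le_of_norm_le_const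
    (f := fun t => prim1 t p) (C := 2 * ‖p‖) fun t _ => abs_prim1_le t p).trans ?_
  have : |x - -1| ≤ 2 := abs_le.2 ⟨by linarith [hx.1], by linarith [hx.2]⟩
  nlinarith [norm_nonneg p]

theorem inner_eq_integral (p q : L2) : inner ℝ p q = ∫ x, p x * q x ∂vol := by
  rw [L2.inner_def]
  refine integral_congr_ae (.of_forall fun x => ?_)
  simp [mul_comm]

theorem norm_sq_eq_integral_zext (p : L2) : ‖p‖ ^ 2 = ∫ x, zext p x ^ 2 := by
  rw [zext, integral_indicator_sq _ measurableSet_Ioo, ← real_inner_self_eq_norm_sq,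
    inner_eq_integral]
  simp only [pow_two]

theorem coeFn_step (x : ℝ) : step x =ᵐ[vol] (Ioc (-1 : ℝ) x).indicator fun _ => (1 : ℝ) :=
  indicatorConstLp_coeFn

/-- Writing the data through step functions turns pairings with it into point values of a primitive,
which is how the jumps `±1/2` enter. -/
theorem uData_eq : uData = step (1 / 2) - step (-1 / 2) - (1 / 2 : ℝ) • step 1 := by
  refine Lp.ext ?_
  have hne : ∀ᵐ x ∂vol, x ≠ -1 / 2 := ae_restrict_of_ae (by simp [ae_iff])
  filter_upwards [boxFun_memLp.coeFn_toLp, Lp.coeFn_sub (step (1 / 2) - step (-1 / 2))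
    ((1 / 2 : ℝ) • step 1), Lp.coeFn_sub (step (1 / 2)) (step (-1 / 2)),
    Lp.coeFn_smul (1 / 2 : ℝ) (step 1), coeFn_step (1 / 2), coeFn_step (-1 / 2), coeFn_step 1,
    ae_restrict_mem measurableSet_Ioo, hne] with x h1 h2 h3 h4 h5 h6 h7 h8 h9
  rw [uData, h1, h2, Pi.sub_apply, h3, Pi.sub_apply, h4, Pi.smul_apply, h5, h6, h7, boxFun]
  have a1 : x ∈ Ioc (-1 : ℝ) 1 := ⟨h8.1, h8.2.le⟩
  rw [indicator_of_mem a1]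
  by_cases hx1 : x ≤ -1 / 2
  · have hx2 : x < -1 / 2 := lt_of_le_of_ne hx1 h9
    rw [indicator_of_notMem (fun h : x ∈ Icc _ _ => absurd h.1 (not_le.2 hx2)),
      indicator_of_mem (show x ∈ Ioc (-1 : ℝ) (1 / 2) from ⟨h8.1, by linarith⟩),
      indicator_of_mem (show x ∈ Ioc (-1 : ℝ) (-1 / 2) from ⟨h8.1, hx1⟩)]
    norm_num
  rw [not_le] at hx1
  rw [indicator_of_notMem (fun h : x ∈ Ioc _ (-1 / 2) => absurd h.2 (not_le.2 hx1))]
  by_cases hx2 : x ≤ 1 / 2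
  · rw [indicator_of_mem (show x ∈ Icc (-1 / 2 : ℝ) (1 / 2) from ⟨hx1.le, hx2⟩),
      indicator_of_mem (show x ∈ Ioc (-1 : ℝ) (1 / 2) from ⟨h8.1, hx2⟩)]
    norm_num
  · rw [indicator_of_notMem (fun h : x ∈ Icc _ _ => hx2 h.2),
      indicator_of_notMem (fun h : x ∈ Ioc _ _ => hx2 h.2)]
    norm_num

theorem inner_uData (p : L2) :
    inner ℝ uData p = prim1 (1 / 2) p - prim1 (-1 / 2) p - 1 / 2 * prim1 1 p := by
  rw [uData_eq, inner_sub_left, inner_sub_left, real_inner_smul_left]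
  rfl

/-! ### Reflection -/

theorem measurePreserving_neg_vol : MeasurePreserving (fun x : ℝ => -x) vol vol := by
  have h := (Measure.measurePreserving_neg (volume : Measure ℝ)).restrict_preimage
    (measurableSet_Ioo : MeasurableSet (Ioo (-1 : ℝ) 1))
  have e : (Neg.neg : ℝ → ℝ) ⁻¹' Ioo (-1 : ℝ) 1 = Ioo (-1 : ℝ) 1 := by
    ext x
    simp [neg_lt, and_comm]
  rwa [e] at h

/-- The reflection `p ↦ p(-·)`. -/
noncomputable def reflect : L2 →ₗᵢ[ℝ] L2 :=
  Lp.compMeasurePreservingₗᵢ ℝ (fun x : ℝ => -x) measurePreserving_neg_vol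

theorem coeFn_reflect (p : L2) : reflect p =ᵐ[vol] fun x => p (-x) :=
  Lp.coeFn_compMeasurePreserving p measurePreserving_neg_vol

theorem zext_reflect (p : L2) : zext (reflect p) =ᵐ[volume] fun x => zext p (-x) := by
  refine (zext_congr (coeFn_reflect p)).trans (.of_forall fun x => ?_)
  by_cases hx : x ∈ Ioo (-1 : ℝ) 1
  · simp only [zext]
    rw [indicator_of_mem hx,
      indicator_of_mem (show -x ∈ Ioo (-1 : ℝ) 1 from ⟨by linarith [hx.2], by linarith [hx.1]⟩)]
  · simp only [zext]
    rw [indicator_of_notMem hx, indicator_of_notMem]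
    exact fun h => hx ⟨by linarith [h.2], by linarith [h.1]⟩

theorem prim1_reflect (x : ℝ) (p : L2) :
    prim1 x (reflect p) = prim1 1 p - prim1 (-x) p := by
  rw [prim1_apply, sigma_one_congr (zext_reflect p), sigma_one_apply,
    intervalIntegral.integral_comp_neg, neg_neg, prim1_apply, prim1_apply,
    sigma_one_sub (intervalIntegrable_of_memLp (memLp_zext p))]

theorem prim2_reflect (x : ℝ) (p : L2) :
    prim2 x (reflect p) = prim1 1 p * (x + 1) - prim2 1 p + prim2 (-x) p := by
  rw [prim2_eq_integral]
  simp only [prim1_reflect]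
  rw [intervalIntegral.integral_sub (g := fun t => prim1 (-t) p) (by simp)
    (((continuous_prim1 p).comp continuous_neg).intervalIntegrable _ _),
    intervalIntegral.integral_const, intervalIntegral.integral_comp_neg (fun t => prim1 t p),
    neg_neg, ← prim2_sub_prim2]
  simp only [smul_eq_mul]
  ring

/-! ### Feasible sets -/

/-- The functions `Φ''` with `Φ` and `Φ'` vanishing at `±1` and `|Φ| ≤ b`. -/
def feas (b : ℝ) : Set L2 :=
  {p | prim1 1 p = 0 ∧ prim2 1 p = 0 ∧ ∀ x ∈ Icc (-1 : ℝ) 1, |prim2 x p| ≤ b}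

theorem reflect_mem_feas {b : ℝ} {p : L2} (hp : p ∈ feas b) : reflect p ∈ feas b := by
  obtain ⟨h1, h2, h3⟩ := hp
  refine ⟨?_, ?_, fun x hx => ?_⟩
  · rw [prim1_reflect, h1, prim1_neg_one, sub_zero]
  · rw [prim2_reflect, h1, h2, prim2_eq_integral, intervalIntegral.integral_same]
    simp
  · rw [prim2_reflect, h1, h2]
    simpa using h3 (-x) ⟨by linarith [hx.2], by linarith [hx.1]⟩

theorem inner_uData_reflect {p : L2} (hp : prim1 1 p = 0) :
    inner ℝ uData (reflect p) = inner ℝ uData p := by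
  rw [inner_uData, inner_uData, prim1_reflect, prim1_reflect, prim1_reflect, hp, prim1_neg_one,
    show -(-1 / 2 : ℝ) = 1 / 2 by norm_num, show (-(1 / 2) : ℝ) = -1 / 2 by norm_num]
  ring

/-- Testing the projection inequality with the reflection gives `⟨p, reflect p⟩ ≥ ‖p‖²`, the
equality case of Cauchy–Schwarz for vectors of equal norm. -/
theorem reflect_eq_self {b : ℝ} {p : L2} (hp : p ∈ feas b)
    (hmin : ∀ q ∈ feas b, inner ℝ (uData - p) (q - p) ≤ 0) : reflect p = p := by
  have h := hmin _ (reflect_mem_feas hp)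
  rw [inner_sub_left, inner_sub_right, inner_uData_reflect hp.1, sub_self, inner_sub_right,
    real_inner_self_eq_norm_sq] at h
  have h2 := norm_sub_sq_real (reflect p) p
  rw [reflect.norm_map, real_inner_comm] at h2
  have h3 : ‖reflect p - p‖ ^ 2 = 0 := le_antisymm (by linarith) (by positivity)
  exact sub_eq_zero.1 (norm_eq_zero.1 (pow_eq_zero_iff two_ne_zero |>.1 h3))

/-! ### The primitive of a projection onto `feas b` -/

/-- The restriction of `k` to `(-1, 0]`. -/
noncomputable def leftPart (k : ℝ → ℝ) (hk : MemLp k 2 volume) : L2 :=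
  ((hk.indicator measurableSet_Iic).restrict _ : MemLp ((Iic (0 : ℝ)).indicator k) 2 vol).toLp _

section leftPart

variable {k : ℝ → ℝ} (hk : MemLp k 2 volume)

theorem coeFn_leftPart : leftPart k hk =ᵐ[vol] (Iic (0 : ℝ)).indicator k := MemLp.coeFn_toLp _

theorem prim1_leftPart_of_nonpos {x : ℝ} (hx : x ∈ Icc (-1 : ℝ) 0) :
    prim1 x (leftPart k hk) = sigma 1 k x := by
  rw [prim1_apply, sigma_one_congr (zext_congr (coeFn_leftPart hk)),
    sigma_one_zext _ ⟨hx.1, hx.2.trans zero_le_one⟩]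
  refine intervalIntegral.integral_congr fun t ht => ?_
  rw [uIcc_of_le hx.1] at ht
  exact indicator_of_mem (show t ∈ Iic 0 from ht.2.trans hx.2) _

theorem prim1_leftPart_of_nonneg {x : ℝ} (hx : x ∈ Icc (0 : ℝ) 1) :
    prim1 x (leftPart k hk) = sigma 1 k 0 := by
  rw [← prim1_leftPart_of_nonpos hk ⟨by norm_num, le_rfl⟩, ← sub_eq_zero, prim1_apply, prim1_apply,
    sigma_one_sub (intervalIntegrable_of_memLp (memLp_zext _)),
    intervalIntegral.integral_congr_ae (g := fun _ => 0), intervalIntegral.integral_zero]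
  filter_upwards [zext_congr (coeFn_leftPart hk)] with t ht ht'
  rw [uIoc_of_le hx.1] at ht'
  rw [ht, zext, indicator_indicator, indicator_of_notMem]
  exact fun h => absurd h.2 (not_le.2 ht'.1)

theorem prim2_leftPart_of_nonpos {x : ℝ} (hx : x ∈ Icc (-1 : ℝ) 0) :
    prim2 x (leftPart k hk) = sigma 2 k x := by
  rw [prim2_eq_integral, sigma_two_apply]
  refine intervalIntegral.integral_congr fun t ht => ?_
  rw [uIcc_of_le hx.1] at ht
  exact prim1_leftPart_of_nonpos hk ⟨ht.1, ht.2.trans hx.2⟩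

theorem prim2_leftPart_of_nonneg (h0 : sigma 1 k 0 = 0) {x : ℝ} (hx : x ∈ Icc (0 : ℝ) 1) :
    prim2 x (leftPart k hk) = sigma 2 k 0 := by
  rw [← prim2_leftPart_of_nonpos hk ⟨by norm_num, le_rfl⟩, ← sub_eq_zero, prim2_sub_prim2,
    intervalIntegral.integral_congr (g := fun _ => 0), intervalIntegral.integral_zero]
  intro t ht
  rw [uIcc_of_le hx.1] at ht
  exact (prim1_leftPart_of_nonneg hk ⟨ht.1, ht.2.trans hx.2⟩).trans h0

theorem norm_sq_leftPart_le : ‖leftPart k hk‖ ^ 2 ≤ ∫ x, k x ^ 2 := by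
  rw [norm_sq_eq_integral_zext, integral_congr_ae
    (g := fun x => (Ioo (-1 : ℝ) 1 ∩ Iic 0).indicator k x ^ 2), integral_indicator_sq _
    (measurableSet_Ioo.inter measurableSet_Iic)]
  · exact setIntegral_le_integral hk.integrable_sq (.of_forall fun x => sq_nonneg _)
  · filter_upwards [zext_congr (coeFn_leftPart hk)] with t ht
    rw [ht, zext, indicator_indicator]

theorem inner_leftPart_reflect : inner ℝ (leftPart k hk) (reflect (leftPart k hk)) = 0 := by
  rw [inner_eq_integral, ← integral_zero ℝ ℝ (μ := vol)]
  refine integral_congr_ae ?_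
  have hne : ∀ᵐ x ∂vol, x ≠ 0 := ae_restrict_of_ae (by simp [ae_iff])
  filter_upwards [coeFn_leftPart hk, coeFn_reflect (leftPart k hk),
    measurePreserving_neg_vol.quasiMeasurePreserving.ae_eq_comp (coeFn_leftPart hk), hne]
    with x h1 h2 h3 h4
  simp only [Function.comp_apply] at h3
  rw [h1, h2, h3]
  rcases lt_or_gt_of_ne h4 with h | h
  · rw [indicator_of_notMem (fun h' : -x ∈ Iic 0 => absurd h' (by simpa using h)), mul_zero]
  · rw [indicator_of_notMem (fun h' : x ∈ Iic 0 => absurd h' (by simpa using h)), zero_mul]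

/-- The even extension of the restriction of `k` to `(-1, 0]`. -/
noncomputable def evenExt : L2 := leftPart k hk + reflect (leftPart k hk)

theorem evenExt_mem_feas (h0 : sigma 1 k 0 = 0) {b : ℝ}
    (hb : ∀ x ∈ Icc (-1 : ℝ) 0, |sigma 2 k x| ≤ b) : evenExt hk ∈ feas b := by
  have e1 : prim1 1 (leftPart k hk) = 0 :=
    (prim1_leftPart_of_nonneg hk ⟨zero_le_one, le_rfl⟩).trans h0
  have e2 : prim2 1 (leftPart k hk) = sigma 2 k 0 :=
    prim2_leftPart_of_nonneg hk h0 ⟨zero_le_one, le_rfl⟩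
  -- Since `σ¹[k](0) = 0`, the second primitive of the even extension is itself even, so the bounds
  -- on the left half suffice.
  have key : ∀ x ∈ Icc (-1 : ℝ) 1, prim2 x (evenExt hk) = sigma 2 k (-|x|) := by
    intro x hx
    rw [evenExt, map_add, prim2_reflect, e1, e2]
    rcases le_total x 0 with h | h
    · rw [prim2_leftPart_of_nonpos hk ⟨hx.1, h⟩,
        prim2_leftPart_of_nonneg hk h0 ⟨by linarith, by linarith [hx.1]⟩, abs_of_nonpos h, neg_neg]
      ring
    · rw [prim2_leftPart_of_nonneg hk h0 ⟨h, hx.2⟩,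
        prim2_leftPart_of_nonpos hk ⟨by linarith [hx.2], by linarith⟩, abs_of_nonneg h]
      ring
  refine ⟨?_, ?_, fun x hx => ?_⟩
  · rw [evenExt, map_add, prim1_reflect, e1, prim1_neg_one]
    simp
  · rw [key 1 (by norm_num), abs_one, sigma_two_apply, intervalIntegral.integral_same]
  · rw [key x hx]
    exact hb _ ⟨neg_le_neg (abs_le.2 hx), neg_nonpos.2 (abs_nonneg x)⟩

theorem norm_sq_evenExt_le : ‖evenExt hk‖ ^ 2 ≤ 2 * ∫ x, k x ^ 2 := by
  rw [evenExt, norm_add_sq_real, inner_leftPart_reflect, reflect.norm_map]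
  linarith [norm_sq_leftPart_le hk]

theorem inner_uData_evenExt (h0 : sigma 1 k 0 = 0) :
    inner ℝ uData (evenExt hk) = -2 * sigma 1 k (-1 / 2) := by
  have e1 : prim1 1 (leftPart k hk) = 0 :=
    (prim1_leftPart_of_nonneg hk ⟨zero_le_one, le_rfl⟩).trans h0
  rw [evenExt, inner_add_right, inner_uData_reflect e1, inner_uData, e1,
    prim1_leftPart_of_nonpos hk (x := -1 / 2) (by norm_num),
    prim1_leftPart_of_nonneg hk (x := 1 / 2) (by norm_num), h0]
  ring

end leftPart

section projection

variable {b : ℝ} {p : L2}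

theorem prim1_odd_of_projection (hp : p ∈ feas b)
    (hmin : ∀ q ∈ feas b, inner ℝ (uData - p) (q - p) ≤ 0) (x : ℝ) :
    prim1 x p = -prim1 (-x) p := by
  have := prim1_reflect x p
  rwa [reflect_eq_self hp hmin, hp.1, zero_sub] at this

theorem sigma_one_indicator_zext (p : L2) {x : ℝ} (hx : x ≤ 0) :
    sigma 1 ((Iic 0).indicator (zext p)) x = prim1 x p := by
  rw [prim1_apply]
  refine intervalIntegral.integral_congr fun t ht => ?_
  exact indicator_of_mem (show t ∈ Iic 0 from ht.2.trans (sup_le (by norm_num) hx)) _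

/-- Any half-interval competitor extends evenly to an element of `feas b`. Energy and pairing with
the data both double, up to an inequality in the favorable direction for the competitor's energy. -/
theorem isHalfMin_of_projection (hp : p ∈ feas b)
    (hmin : ∀ q ∈ feas b, inner ℝ (uData - p) (q - p) ≤ 0) :
    IsHalfMin b ((Iic 0).indicator (zext p)) := by
  have hR := reflect_eq_self hp hmin
  have hodd := prim1_odd_of_projection hp hmin
  have s2 : ∀ x ∈ Icc (-1 : ℝ) 0, sigma 2 ((Iic 0).indicator (zext p)) x = prim2 x p := by
    intro x hx
    rw [prim2_eq_integral]
    refine intervalIntegral.integral_congr fun t ht => sigma_one_indicator_zext p ?_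
    rw [uIcc_of_le hx.1] at ht
    exact ht.2.trans hx.2
  have energy : 2 * ∫ x, (Iic 0).indicator (zext p) x ^ 2 = ‖p‖ ^ 2 := by
    have hint := (memLp_zext p).integrable_sq
    rw [norm_sq_eq_integral_zext, ← integral_add_compl (measurableSet_Iic (a := (0 : ℝ))) hint,
      integral_indicator_sq _ measurableSet_Iic, two_mul, compl_Iic]
    congr 1
    rw [show ∫ x in Iic (0 : ℝ), zext p x ^ 2 = ∫ x in Iic (-0 : ℝ), zext p x ^ 2 by rw [neg_zero],
      ← integral_comp_neg_Ioi 0 (fun x => zext p x ^ 2)]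
    refine integral_congr_ae (ae_restrict_of_ae ?_)
    have := zext_reflect p
    rw [hR] at this
    filter_upwards [this] with x hx
    simp only [hx]
  refine ⟨(memLp_zext p).indicator measurableSet_Iic, ?_, fun x hx => ?_, fun k hk k0 kb => ?_⟩
  · have := hodd 0
    rw [neg_zero] at this
    rw [sigma_one_indicator_zext p le_rfl]
    linarith
  · rw [s2 x hx]
    exact hp.2.2 x ⟨hx.1, hx.2.trans zero_le_one⟩
  · have h1 := hmin _ (evenExt_mem_feas hk k0 kb)
    have h2 := inner_uData_evenExt hk k0
    have h3 := norm_sq_evenExt_le hk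
    have h4 := inner_uData p
    have h5 := hodd (1 / 2)
    have h6 := norm_sub_sq_real (evenExt hk) p
    have h7 := sq_nonneg ‖evenExt hk - p‖
    rw [show (-(1 / 2) : ℝ) = -1 / 2 by norm_num] at h5
    rw [hp.1] at h4
    rw [inner_sub_left, inner_sub_right, inner_sub_right, real_inner_self_eq_norm_sq,
      real_inner_comm (evenExt hk) p] at h1
    rw [sigma_one_indicator_zext p (by norm_num)]
    linarith

/-- The primitive of the projection of the data onto `feas b` is largest at `±1/2`. -/
theorem abs_prim1_le_of_projection (hp : p ∈ feas b)
    (hmin : ∀ q ∈ feas b, inner ℝ (uData - p) (q - p) ≤ 0) :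
    ∀ x ∈ Icc (-1 : ℝ) 1, |prim1 x p| ≤ 1 / 2 * inner ℝ uData p := by
  have hodd := prim1_odd_of_projection hp hmin
  have h4 := inner_uData p
  have h5 := hodd (1 / 2)
  rw [show (-(1 / 2) : ℝ) = -1 / 2 by norm_num] at h5
  rw [hp.1] at h4
  have key : ∀ x ∈ Icc (-1 : ℝ) 0, |prim1 x p| ≤ 1 / 2 * inner ℝ uData p := by
    intro x hx
    have := (isHalfMin_of_projection hp hmin).abs_sigma_le x hx
    rw [sigma_one_indicator_zext p hx.2, sigma_one_indicator_zext p (by norm_num)] at this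
    linarith
  intro x hx
  rcases le_total x 0 with h | h
  · exact key x ⟨hx.1, h⟩
  · rw [hodd, abs_neg]
    exact key (-x) ⟨by linarith [hx.2], by linarith⟩

end projection

/-! ### Test functions -/

theorem isTest_of_tsupport_subset {φ : ℝ → ℝ} (h : ContDiff ℝ ∞ φ) {a b : ℝ} (ha : -1 < a)
    (hb : b < 1) (hs : Function.support φ ⊆ Icc a b) : IsTest φ := by
  have hs' : tsupport φ ⊆ Icc a b := closure_minimal hs isClosed_Icc
  exact ⟨h, IsCompact.of_isClosed_subset isCompact_Icc (isClosed_tsupport _) hs',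
    hs'.trans fun x hx => ⟨ha.trans_le hx.1, hx.2.trans_lt hb⟩⟩

namespace IsTest

variable {φ ψ : ℝ → ℝ}

theorem exists_support_subset (hφ : IsTest φ) :
    ∃ a b : ℝ, -1 < a ∧ a ≤ b ∧ b < 1 ∧ Function.support φ ⊆ Icc a b := by
  have hK : IsCompact (insert (0 : ℝ) (tsupport φ)) := hφ.2.1.isCompact.insert 0
  obtain ⟨a, ha, hmin⟩ := hK.exists_isLeast ⟨0, mem_insert _ _⟩
  obtain ⟨b, hb, hmax⟩ := hK.exists_isGreatest ⟨0, mem_insert _ _⟩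
  have hsub : insert (0 : ℝ) (tsupport φ) ⊆ Ioo (-1) 1 :=
    insert_subset (by norm_num) hφ.2.2
  refine ⟨a, b, (hsub ha).1, hmin hb, (hsub hb).2, fun x hx => ?_⟩
  have hx' : x ∈ insert (0 : ℝ) (tsupport φ) := mem_insert_of_mem _ (subset_tsupport φ hx)
  exact ⟨hmin hx', hmax hx'⟩

theorem eq_zero_of_notMem (hφ : IsTest φ) {x : ℝ} (hx : x ∉ Ioo (-1 : ℝ) 1) : φ x = 0 :=
  image_eq_zero_of_notMem_tsupport fun h => hx (hφ.2.2 h)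

theorem add (hφ : IsTest φ) (hψ : IsTest ψ) : IsTest (φ + ψ) := by
  obtain ⟨a, b, ha, hab, hb, hs⟩ := hφ.exists_support_subset
  obtain ⟨c, d, hc, hcd, hd, ht⟩ := hψ.exists_support_subset
  refine isTest_of_tsupport_subset (hφ.1.add hψ.1) (lt_min ha hc) (max_lt hb hd) ?_
  refine (Function.support_add φ ψ).trans (union_subset (hs.trans ?_) (ht.trans ?_))
  · exact Icc_subset_Icc (min_le_left _ _) (le_max_left _ _)
  · exact Icc_subset_Icc (min_le_right _ _) (le_max_right _ _)

theorem const_smul (hφ : IsTest φ) (c : ℝ) : IsTest (c • φ) := by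
  obtain ⟨a, b, ha, hab, hb, hs⟩ := hφ.exists_support_subset
  exact isTest_of_tsupport_subset (contDiff_const.smul hφ.1) ha hb
    ((Function.support_const_smul_subset c φ).trans hs)

theorem zero : IsTest (0 : ℝ → ℝ) :=
  isTest_of_tsupport_subset contDiff_const (a := 0) (b := 0) (by norm_num) (by norm_num) (by simp)

theorem deriv (hφ : IsTest φ) : IsTest (deriv φ) := by
  obtain ⟨a, b, ha, hab, hb, hs⟩ := hφ.exists_support_subset
  refine isTest_of_tsupport_subset (contDiff_infty_iff_deriv.1 hφ.1).2 ha hb ?_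
  exact support_deriv_subset.trans (closure_minimal hs isClosed_Icc)

theorem intervalIntegrable (hφ : IsTest φ) (a b : ℝ) : IntervalIntegrable φ volume a b :=
  hφ.1.continuous.intervalIntegrable a b

theorem sigma_one_deriv (hφ : IsTest φ) (x : ℝ) : sigma 1 (_root_.deriv φ) x = φ x := by
  rw [sigma_one_apply, intervalIntegral.integral_deriv_eq_sub
    (fun t _ => (hφ.1.differentiable (by simp)).differentiableAt)
    (hφ.deriv.intervalIntegrable _ _), hφ.eq_zero_of_notMem (x := -1) (by simp), sub_zero]

theorem hasDerivAt_sigma_one (hφ : IsTest φ) (x : ℝ) : HasDerivAt (sigma 1 φ) (φ x) x :=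
  hφ.1.continuous.integral_hasStrictDerivAt (-1) x |>.hasDerivAt

theorem deriv_sigma_one (hφ : IsTest φ) : _root_.deriv (sigma 1 φ) = φ :=
  funext fun x => (hφ.hasDerivAt_sigma_one x).deriv

theorem sigma_one (hφ : IsTest φ) (h : Denoising.sigma 1 φ 1 = 0) : IsTest (sigma 1 φ) := by
  obtain ⟨a, b, ha, hab, hb, hs⟩ := hφ.exists_support_subset
  have hz : ∀ x y, (∀ t ∈ uIoo x y, t ∉ Icc a b) → sigma 1 φ x = sigma 1 φ y := by
    intro x y hxy
    rw [← sub_eq_zero, sigma_one_sub hφ.intervalIntegrable,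
      intervalIntegral.integral_congr_uIoo (g := fun _ => 0), intervalIntegral.integral_zero]
    intro t ht
    by_contra hcon
    exact hxy t (uIoo_comm x y ▸ ht) (hs hcon)
  refine isTest_of_tsupport_subset (contDiff_infty_iff_deriv.2
    ⟨fun x => (hφ.hasDerivAt_sigma_one x).differentiableAt, ?_⟩) ha hb fun x hx => ?_
  · rw [hφ.deriv_sigma_one]
    exact hφ.1
  · by_contra hcon
    refine hx ?_
    rw [mem_Icc, not_and_or, not_le, not_le] at hcon
    rcases hcon with hcon | hcon
    · rw [hz x (-1), sigma_one_neg_one]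
      exact fun t ht ht' => absurd (ht.2.trans (max_lt hcon ha)) (not_lt.2 ht'.1)
    · rw [hz x 1, h]
      exact fun t ht ht' => absurd ((lt_min hcon hb).trans ht.1) (not_lt.2 ht'.2)

end IsTest

/-- The `i`-th derivatives of the test functions satisfying `P`, as elements of `L²(-1, 1)`. -/
def testSet (i : ℕ) (P : (ℝ → ℝ) → Prop) : Set L2 :=
  {p | ∃ φ, IsTest φ ∧ P φ ∧ p =ᵐ[vol] iteratedDeriv i φ}

theorem sigma_congr_vol {p q : ℝ → ℝ} (h : p =ᵐ[vol] q) {x : ℝ} (hx : x ∈ Icc (-1 : ℝ) 1) :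
    sigma 1 p x = sigma 1 q x := by
  rw [← sigma_one_zext p hx, ← sigma_one_zext q hx, sigma_one_congr (zext_congr h)]

theorem prim1_congr {p : L2} {g : ℝ → ℝ} (h : p =ᵐ[vol] g) {x : ℝ} (hx : x ∈ Icc (-1 : ℝ) 1) :
    prim1 x p = sigma 1 g x := by
  rw [prim1_eq_sigma p hx, sigma_congr_vol h hx]

theorem prim2_congr {p : L2} {g : ℝ → ℝ} (h : p =ᵐ[vol] g) {x : ℝ} (hx : x ∈ Icc (-1 : ℝ) 1) :
    prim2 x p = sigma 2 g x := by
  rw [prim2_eq_integral, sigma_two_apply]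
  refine intervalIntegral.integral_congr fun t ht => ?_
  rw [uIcc_of_le hx.1] at ht
  exact prim1_congr h ⟨ht.1, ht.2.trans hx.2⟩

section

variable {p : L2} {φ : ℝ → ℝ} {x : ℝ}

theorem prim1_of_deriv (hφ : IsTest φ) (h : p =ᵐ[vol] iteratedDeriv 1 φ)
    (hx : x ∈ Icc (-1 : ℝ) 1) : prim1 x p = φ x := by
  rw [prim1_congr h hx, iteratedDeriv_one, hφ.sigma_one_deriv]

theorem prim1_of_deriv_two (hφ : IsTest φ) (h : p =ᵐ[vol] iteratedDeriv 2 φ)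
    (hx : x ∈ Icc (-1 : ℝ) 1) : prim1 x p = deriv φ x := by
  rw [prim1_congr h hx, iteratedDeriv_succ, iteratedDeriv_one, hφ.deriv.sigma_one_deriv]

theorem prim2_of_deriv_two (hφ : IsTest φ) (h : p =ᵐ[vol] iteratedDeriv 2 φ)
    (hx : x ∈ Icc (-1 : ℝ) 1) : prim2 x p = φ x := by
  rw [prim2_eq_integral, ← hφ.sigma_one_deriv x, sigma_one_apply]
  refine intervalIntegral.integral_congr fun t ht => ?_
  rw [uIcc_of_le hx.1] at ht
  exact prim1_of_deriv_two hφ h ⟨ht.1, ht.2.trans hx.2⟩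

end

/-! ### Density of test functions under moment conditions and bounds -/

/-- The subspace of test functions. -/
def testSubmodule : Submodule ℝ L2 where
  carrier := {p | ∃ φ, IsTest φ ∧ p =ᵐ[vol] φ}
  add_mem' := by
    rintro p q ⟨φ, hφ, hp⟩ ⟨ψ, hψ, hq⟩
    exact ⟨φ + ψ, hφ.add hψ, (Lp.coeFn_add p q).trans (hp.add hq)⟩
  zero_mem' := ⟨0, IsTest.zero, Lp.coeFn_zero ℝ 2 vol⟩
  smul_mem' := by
    rintro c p ⟨φ, hφ, hp⟩
    exact ⟨c • φ, hφ.const_smul c, (Lp.coeFn_smul c p).trans (hp.const_smul c)⟩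

theorem topologicalClosure_testSubmodule : testSubmodule.topologicalClosure = ⊤ := by
  rw [Submodule.topologicalClosure_eq_top_iff, Submodule.eq_bot_iff]
  intro g hg
  rw [Submodule.mem_orthogonal] at hg
  have hloc : LocallyIntegrableOn g (Ioo (-1 : ℝ) 1) volume :=
    IntegrableOn.locallyIntegrableOn ((Lp.memLp g).integrable one_le_two)
  have key := isOpen_Ioo.ae_eq_zero_of_integral_contDiff_smul_eq_zero hloc fun φ h1 h2 h3 => by
    have hφ : IsTest φ := ⟨h1, h2, h3⟩
    have hm := hφ.memLp 0
    rw [iteratedDeriv_zero] at hm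
    have := hg (hm.toLp φ) ⟨φ, hφ, hm.coeFn_toLp⟩
    rw [inner_eq_integral] at this
    rw [← this, ← setIntegral_eq_integral_of_forall_compl_eq_zero (s := Ioo (-1 : ℝ) 1)]
    · refine integral_congr_ae ?_
      filter_upwards [hm.coeFn_toLp] with x hx
      rw [hx, smul_eq_mul]
    · intro x hx
      rw [hφ.eq_zero_of_notMem hx, zero_smul]
  refine Lp.ext ?_
  filter_upwards [ae_restrict_of_ae key, ae_restrict_mem measurableSet_Ioo,
    Lp.coeFn_zero ℝ 2 vol] with x h1 h2 h3
  rw [h1 h2, h3, Pi.zero_apply]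

theorem exists_isTest_sigma_one_eq_one : ∃ ρ, IsTest ρ ∧ sigma 1 ρ 1 = 1 := by
  let B : ContDiffBump (0 : ℝ) := ⟨1 / 4, 1 / 2, by norm_num, by norm_num⟩
  have hs : Function.support (B.normed volume) ⊆ Icc (-1 / 2) (1 / 2) := by
    rw [B.support_normed_eq, Real.ball_eq_Ioo]
    refine Ioo_subset_Icc_self.trans (Icc_subset_Icc ?_ ?_) <;> norm_num [B]
  refine ⟨B.normed volume, isTest_of_tsupport_subset B.contDiff_normed (by norm_num)
    (by norm_num) hs, ?_⟩
  rw [sigma_one_apply, intervalIntegral.integral_of_le (by norm_num),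
    setIntegral_eq_integral_of_forall_compl_eq_zero, B.integral_normed]
  intro x hx
  by_contra hcon
  have := hs hcon
  exact hx ⟨by linarith [this.1], by linarith [this.2]⟩

/-- A continuous linear correction `T` removes both moments using two fixed test functions. It fixes
`p` and sends test functions to test functions with vanishing moments, which are second derivatives
of test functions; density is transported through `T`. -/
theorem mem_closure_testSet_two {p : L2} (h1 : prim1 1 p = 0) (h2 : prim2 1 p = 0) :
    p ∈ closure (testSet 2 fun _ => True) := by
  obtain ⟨ρ, hρ, hρ1⟩ := exists_isTest_sigma_one_eq_one
  have m0 := hρ.memLp 0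
  have m1 := hρ.memLp 1
  rw [iteratedDeriv_zero] at m0
  rw [iteratedDeriv_one] at m1
  have one_mem : (1 : ℝ) ∈ Icc (-1 : ℝ) 1 := by norm_num
  set r0 : L2 := m0.toLp ρ
  set r1 : L2 := m1.toLp (deriv ρ)
  have r01 : prim1 1 r0 = 1 := by rw [prim1_congr m0.coeFn_toLp one_mem, hρ1]
  have r11 : prim1 1 r1 = 0 := by
    rw [prim1_congr m1.coeFn_toLp one_mem, hρ.sigma_one_deriv, hρ.eq_zero_of_notMem (by simp)]
  have r12 : prim2 1 r1 = 1 := by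
    rw [prim2_congr m1.coeFn_toLp one_mem, sigma_two_apply]
    simp only [hρ.sigma_one_deriv]
    exact hρ1
  let A : L2 →L[ℝ] ℝ := prim1 1
  -- The subtracted multiple compensates for the second moment that removing `A q • r0` introduces.
  let B : L2 →L[ℝ] ℝ := prim2 1 - prim2 1 r0 • prim1 1
  let T : L2 → L2 := fun q => q - A q • r0 - B q • r1
  have hT : Continuous T := by fun_prop
  have hTp : T p = p := by simp [T, A, B, h1, h2]
  have hmem : p ∈ closure (testSubmodule : Set L2) := by
    rw [← Submodule.topologicalClosure_coe, topologicalClosure_testSubmodule]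
    trivial
  have h3 : T p ∈ closure (T '' (testSubmodule : Set L2)) :=
    image_closure_subset_closure_image hT ⟨p, hmem, rfl⟩
  rw [hTp] at h3
  refine closure_mono ?_ h3
  rintro _ ⟨q, hq, rfl⟩
  have hTq : T q ∈ testSubmodule := by
    refine testSubmodule.sub_mem (testSubmodule.sub_mem hq (testSubmodule.smul_mem _ ?_))
      (testSubmodule.smul_mem _ ?_)
    · exact ⟨ρ, hρ, m0.coeFn_toLp⟩
    · exact ⟨deriv ρ, hρ.deriv, m1.coeFn_toLp⟩
  have t1 : prim1 1 (T q) = 0 := by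
    simp only [T, map_sub, map_smul, smul_eq_mul, r01, r11, A]
    ring
  have t2 : prim2 1 (T q) = 0 := by
    simp only [T, map_sub, map_smul, r12, A, B, sub_apply, smul_apply, smul_eq_mul]
    ring
  obtain ⟨η, hη, hTη⟩ := hTq
  rw [prim1_congr hTη one_mem] at t1
  rw [prim2_congr hTη one_mem] at t2
  have hη1 := hη.sigma_one t1
  refine ⟨sigma 1 (sigma 1 η), hη1.sigma_one t2, trivial, ?_⟩
  rw [iteratedDeriv_succ, iteratedDeriv_one, hη1.deriv_sigma_one, hη.deriv_sigma_one]
  exact hTη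

/-- A function with vanishing moments and bounded primitives is a limit of second derivatives of
test functions satisfying the same bounds. -/
theorem mem_closure_testSet_of_bounds {p : L2} {a b : ℝ} (ha : 0 < a) (hb : 0 < b)
    (h1 : prim1 1 p = 0) (h2 : prim2 1 p = 0) (hpa : ∀ x ∈ Icc (-1 : ℝ) 1, |prim1 x p| ≤ a)
    (hpb : ∀ x ∈ Icc (-1 : ℝ) 1, |prim2 x p| ≤ b) :
    p ∈ closure (testSet 2 fun φ =>
      (∀ x ∈ Ioo (-1 : ℝ) 1, |deriv φ x| ≤ a) ∧ ∀ x ∈ Ioo (-1 : ℝ) 1, |φ x| ≤ b) := by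
  rw [Metric.mem_closure_iff]
  intro ε hε
  have hN : 0 < ‖p‖ + 1 := by positivity
  -- Approximating within `δ` in norm violates the bounds by at most `2δ` and `4δ`. Shrinking by `1
  -- - t` absorbs this because `(1 - t)(1 + t) ≤ 1`, and it costs at most `t‖p‖ < ε/2` in norm.
  set t := min (1 / 2) (ε / (2 * (‖p‖ + 1))) with ht
  have ht0 : 0 < t := lt_min (by norm_num) (by positivity)
  have ht1 : t ≤ 1 / 2 := min_le_left _ _
  have htp : t * ‖p‖ < ε / 2 := by
    have h3 : t ≤ ε / (2 * (‖p‖ + 1)) := min_le_right _ _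
    rw [le_div_iff₀ (by positivity)] at h3
    nlinarith
  set δ := min (ε / 2) (min (t * a / 2) (t * b / 4)) with hδ
  have hδ0 : 0 < δ := lt_min (by positivity) (lt_min (by positivity) (by positivity))
  have hδ1 : δ ≤ ε / 2 := min_le_left _ _
  have hδ2 : δ ≤ t * a / 2 := (min_le_right _ _).trans (min_le_left _ _)
  have hδ3 : δ ≤ t * b / 4 := (min_le_right _ _).trans (min_le_right _ _)
  obtain ⟨q, ⟨φ, hφ, -, hq⟩, hpq⟩ := Metric.mem_closure_iff.1 (mem_closure_testSet_two h1 h2) δ hδ0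
  rw [dist_comm, dist_eq_norm] at hpq
  have hbound : ∀ (L : L2 →L[ℝ] ℝ) (M C : ℝ), |L p| ≤ M → |L (q - p)| ≤ C * ‖q - p‖ →
      0 < C → C * δ ≤ t * M → |(1 - t) * L q| ≤ M := by
    intro L M C hM hC hC0 hCδ
    have e : L q = L p + L (q - p) := by rw [map_sub]; ring
    have h4 : |L q| ≤ M + C * δ := by
      rw [e]
      refine (abs_add_le _ _).trans (add_le_add hM (hC.trans ?_))
      exact mul_le_mul_of_nonneg_left hpq.le hC0.le
    have h6 : 0 ≤ C * δ := by positivity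
    rw [abs_mul, abs_of_pos (by linarith : 0 < 1 - t)]
    nlinarith [abs_nonneg (L q)]
  have hmem : ∀ {x : ℝ}, x ∈ Ioo (-1 : ℝ) 1 → x ∈ Icc (-1 : ℝ) 1 := fun h => Ioo_subset_Icc_self h
  refine ⟨(1 - t) • q, ⟨(1 - t) • φ, hφ.const_smul _, ⟨fun x hx => ?_, fun x hx => ?_⟩, ?_⟩, ?_⟩
  · rw [deriv_const_smul_field, smul_eq_mul, ← prim1_of_deriv_two hφ hq (hmem hx)]
    exact hbound _ a 2 (hpa x (hmem hx)) (abs_prim1_le x _) two_pos (by linarith)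
  · rw [Pi.smul_apply, smul_eq_mul, ← prim2_of_deriv_two hφ hq (hmem hx)]
    exact hbound _ b 4 (hpb x (hmem hx)) (abs_prim2_le (hmem hx) _) four_pos (by linarith)
  · filter_upwards [Lp.coeFn_smul (1 - t) q, hq] with x h3 h4
    rw [h3, Pi.smul_apply, h4, iteratedDeriv_const_smul_field]
  · rw [dist_comm, dist_eq_norm, show (1 - t) • q - p = (1 - t) • (q - p) - t • p by module]
    refine (norm_sub_le _ _).trans_lt ?_
    rw [norm_smul, norm_smul, Real.norm_of_nonneg ht0.le, Real.norm_of_nonneg (by linarith)]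
    nlinarith [norm_nonneg (q - p)]

/-! ### Minimizers as projections -/

/-- Fenchel duality in concrete form: the projection inequality says that `p` attains the support
function at `f - p`, and the quadratic term gives strict growth away from that point. -/
theorem isMinimizer_iff {R : L2 → EReal} {f : L2} {S : Set L2}
    (hR : ∀ u, R u = ⨆ p ∈ S, ((inner ℝ p u : ℝ) : EReal)) {p : L2} (hp : p ∈ closure S)
    (hvar : ∀ q ∈ S, inner ℝ (f - p) (q - p) ≤ 0) (u : L2) :
    IsMinimizer R f u ↔ u = f - p := by
  have hle : ∀ w, ((inner ℝ p w : ℝ) : EReal) ≤ R w := by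
    intro w
    have hcl : IsClosed {q : L2 | ((inner ℝ q w : ℝ) : EReal) ≤ R w} :=
      isClosed_le (continuous_coe_real_ereal.comp (by fun_prop)) continuous_const
    refine closure_minimal (fun q hq => ?_) hcl hp
    rw [Set.mem_ofPred_eq, hR w]
    exact le_iSup₂_of_le q hq le_rfl
  have heq : R (f - p) = ((inner ℝ p (f - p) : ℝ) : EReal) := by
    refine le_antisymm ?_ (hle _)
    rw [hR]
    refine iSup₂_le fun q hq => EReal.coe_le_coe_iff.2 ?_
    have h := hvar q hq
    rw [inner_sub_right] at h
    rw [real_inner_comm (f - p) q, real_inner_comm (f - p) p]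
    linarith
  have key : ∀ w, functional R f (f - p) + ((1 / 2 * ‖w - (f - p)‖ ^ 2 : ℝ) : EReal)
      ≤ functional R f w := by
    intro w
    unfold functional
    rw [heq, integral_sq_eq, integral_sq_eq]
    refine le_trans ?_ (add_le_add_right (hle w) _)
    norm_cast
    have e : w - (f - p) = (w - f) + p := by abel
    have e' : f - p - f = -p := by abel
    rw [e, e', norm_add_sq_real, norm_neg, inner_sub_right, real_inner_self_eq_norm_sq,
      inner_sub_left, real_inner_comm p w, real_inner_comm p f]
    linarith
  have hreal : functional R f (f - p) =
      ((1 / 2 * (∫ x, ((f - p : L2) x - f x) ^ 2 ∂vol) + inner ℝ p (f - p) : ℝ) : EReal) := by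
    unfold functional
    rw [heq]
    norm_cast
  constructor
  · intro hu
    have h := (key u).trans (hu (f - p))
    rw [hreal] at h
    norm_cast at h
    have h2 : ‖u - (f - p)‖ ^ 2 = 0 := le_antisymm (by linarith) (by positivity)
    exact sub_eq_zero.1 (norm_eq_zero.1 (pow_eq_zero_iff two_ne_zero |>.1 h2))
  · rintro rfl w
    refine le_trans (le_add_of_nonneg_right ?_) (key w)
    exact_mod_cast (by positivity : (0 : ℝ) ≤ 1 / 2 * ‖w - (f - p)‖ ^ 2)

theorem integral_mul_eq_inner {p : L2} {g : ℝ → ℝ} (hp : p =ᵐ[vol] g) (u : L2) :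
    ∫ x, u x * g x ∂vol = inner ℝ p u := by
  rw [inner_eq_integral]
  refine integral_congr_ae ?_
  filter_upwards [hp] with x hx
  rw [hx, mul_comm]

theorem iSup_testSet (i : ℕ) (P : (ℝ → ℝ) → Prop) (u : L2) :
    (⨆ (φ : ℝ → ℝ) (_ : IsTest φ) (_ : P φ),
      ((∫ x, u x * iteratedDeriv i φ x ∂vol : ℝ) : EReal)) =
    ⨆ p ∈ testSet i P, ((inner ℝ p u : ℝ) : EReal) := by
  refine le_antisymm (iSup_le fun φ => iSup₂_le fun hφ hP => ?_) (iSup₂_le ?_)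
  · have hp := (hφ.memLp i).coeFn_toLp
    rw [integral_mul_eq_inner hp]
    exact le_iSup₂_of_le ((hφ.memLp i).toLp _) ⟨φ, hφ, hP, hp⟩ le_rfl
  · rintro p ⟨φ, hφ, hP, hp⟩
    rw [← integral_mul_eq_inner hp]
    exact le_iSup_of_le φ (le_iSup₂_of_le hφ hP le_rfl)

theorem TV_eq_iSup (i : ℕ) (α : ℝ≥0) (u : L2) :
    TV i α u = ⨆ p ∈ testSet i fun φ => ∀ x ∈ Ioo (-1 : ℝ) 1, |φ x| ≤ α,
      ((inner ℝ p u : ℝ) : EReal) :=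
  iSup_testSet i _ u

theorem TGV_eq_iSup (a b : ℝ≥0) (u : L2) :
    TGV a b u = ⨆ p ∈ testSet 2 fun φ => (∀ x ∈ Ioo (-1 : ℝ) 1, |deriv φ x| ≤ a) ∧
      ∀ x ∈ Ioo (-1 : ℝ) 1, |φ x| ≤ b, ((inner ℝ p u : ℝ) : EReal) := by
  rw [← iSup_testSet, TGV]
  simp only [iSup_and]

theorem tvMin_eq {i : ℕ} {α : ℝ≥0} {f p : L2}
    (hp : p ∈ closure (testSet i fun φ => ∀ x ∈ Ioo (-1 : ℝ) 1, |φ x| ≤ α))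
    (hvar : ∀ q ∈ testSet i fun φ => ∀ x ∈ Ioo (-1 : ℝ) 1, |φ x| ≤ α,
      inner ℝ (f - p) (q - p) ≤ 0) : tvMin i α f = f - p :=
  (isMinimizer_iff (TV_eq_iSup i α) hp hvar _).1 (existsUnique_isMinimizer_TV i α f).choose_spec.1

/-! ### The dual norm -/

/-- A signed step function has total variation at most 1, because its pairing with `φ'` is `±φ(x)`.
-/
theorem prim1_mul_le_starTV {p : L2} {x : ℝ} (hx : x ∈ Icc (-1 : ℝ) 1) {ε : ℝ}
    (hε : ε = 1 ∨ ε = -1) : ((ε * prim1 x p : ℝ) : EReal) ≤ starTV p := by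
  have hu : TV 1 1 (ε • step x) ≤ 1 := by
    rw [TV_eq_iSup]
    refine iSup₂_le ?_
    rintro q ⟨φ, hφ, hφ1, hq⟩
    rw [real_inner_comm, real_inner_smul_left, ← prim1_eq_inner, prim1_of_deriv hφ hq hx]
    have h1 : |φ x| ≤ 1 := by
      by_cases hx' : x ∈ Ioo (-1 : ℝ) 1
      · simpa using hφ1 x hx'
      · rw [hφ.eq_zero_of_notMem hx', abs_zero]
        exact zero_le_one
    rw [abs_le] at h1
    have : ε * φ x ≤ 1 := by rcases hε with rfl | rfl <;> linarith
    exact_mod_cast this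
  refine le_iSup₂_of_le (ε • step x) hu (le_of_eq ?_)
  rw [← inner_eq_integral, real_inner_comm, real_inner_smul_left, ← prim1_eq_inner]

theorem starTV_le_of_mem_closure {p : L2} {a : ℝ} (ha : 0 < a)
    (hp : p ∈ closure (testSet 1 fun φ => ∀ x ∈ Ioo (-1 : ℝ) 1, |φ x| ≤ a)) :
    starTV p ≤ (a : EReal) := by
  refine iSup₂_le fun u hu => ?_
  rw [← inner_eq_integral, EReal.coe_le_coe_iff]
  have hcl : IsClosed {q : L2 | inner ℝ q u ≤ a} := isClosed_le (by fun_prop) continuous_const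
  refine closure_minimal ?_ hcl hp
  rintro q ⟨φ, hφ, hφa, hq⟩
  have h1 : ((inner ℝ (a⁻¹ • q) u : ℝ) : EReal) ≤ 1 := by
    refine le_trans ?_ hu
    rw [TV_eq_iSup]
    refine le_iSup₂_of_le (a⁻¹ • q) ⟨a⁻¹ • φ, hφ.const_smul _, fun x hx => ?_, ?_⟩ le_rfl
    · rw [Pi.smul_apply, smul_eq_mul, abs_mul, abs_of_pos (inv_pos.2 ha), NNReal.coe_one,
        inv_mul_le_one₀ ha]
      exact hφa x hx
    · filter_upwards [Lp.coeFn_smul a⁻¹ q, hq] with x h3 h4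
      rw [h3, Pi.smul_apply, h4, iteratedDeriv_const_smul_field]
  have h2 : inner ℝ (a⁻¹ • q) u ≤ (1 : ℝ) := by exact_mod_cast h1
  rwa [real_inner_smul_left, inv_mul_le_one₀ ha] at h2

theorem mem_closure_testSet_one {p : L2} {a : ℝ} (ha : 0 < a) (h1 : prim1 1 p = 0)
    (h2 : prim2 1 p = 0) (hpa : ∀ x ∈ Icc (-1 : ℝ) 1, |prim1 x p| ≤ a) :
    p ∈ closure (testSet 1 fun φ => ∀ x ∈ Ioo (-1 : ℝ) 1, |φ x| ≤ a) := by
  -- The bound on the second primitive is chosen so large that it holds automatically.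
  refine closure_mono ?_ (mem_closure_testSet_of_bounds ha (b := 4 * ‖p‖ + 1) (by positivity)
    h1 h2 hpa fun x hx => (abs_prim2_le hx p).trans (by linarith))
  rintro q ⟨φ, hφ, ⟨hφa, -⟩, hq⟩
  exact ⟨deriv φ, hφ.deriv, hφa, by rwa [iteratedDeriv_one, ← iteratedDeriv_one (f := φ),
    ← iteratedDeriv_succ]⟩

theorem starTV_eq {p : L2} {a x₀ ε : ℝ} (h1 : prim1 1 p = 0) (h2 : prim2 1 p = 0)
    (hpa : ∀ x ∈ Icc (-1 : ℝ) 1, |prim1 x p| ≤ a) (hx₀ : x₀ ∈ Icc (-1 : ℝ) 1)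
    (hε : ε = 1 ∨ ε = -1) (he : ε * prim1 x₀ p = a) : starTV p = (a : EReal) := by
  -- Passing to every `z > a` covers `a = 0`, where the approximation lemma does not apply directly.
  refine le_antisymm (EReal.le_of_forall_lt_iff_le.1 fun z hz => ?_)
    (he ▸ prim1_mul_le_starTV hx₀ hε)
  have ha : 0 ≤ a := (abs_nonneg _).trans (hpa _ hx₀)
  have hz' : a < z := by exact_mod_cast hz
  exact starTV_le_of_mem_closure (ha.trans_lt hz')
    (mem_closure_testSet_one (ha.trans_lt hz') h1 h2 fun x hx => (hpa x hx).trans hz'.le)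

/-! ### The data -/

theorem prim1_step {x y : ℝ} (hx : x ∈ Icc (-1 : ℝ) 1) (hy : y ∈ Icc (-1 : ℝ) 1) :
    prim1 y (step x) = min y x + 1 := by
  rw [prim1_eq_inner, step, step, L2.real_inner_indicatorConstLp_one_indicatorConstLp_one,
    Ioc_inter_Ioc, max_self, vol, restrict_Ioo_eq_restrict_Ioc, Measure.real,
    Measure.restrict_apply measurableSet_Ioc, Ioc_inter_Ioc, max_self, Real.volume_Ioc,
    min_eq_left ((min_le_left y x).trans hy.2), sub_neg_eq_add, ENNReal.toReal_ofReal]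
  linarith [le_min hy.1 hx.1]

theorem prim1_uData {x : ℝ} (hx : x ∈ Icc (-1 : ℝ) 1) :
    prim1 x uData = min x (1 / 2) - min x (-1 / 2) - (x + 1) / 2 := by
  rw [uData_eq, map_sub, map_sub, map_smul, prim1_step (by norm_num) hx,
    prim1_step (by norm_num) hx, prim1_step (by norm_num) hx, min_eq_left hx.2, smul_eq_mul]
  ring

theorem prim1_one_uData : prim1 1 uData = 0 := by
  rw [prim1_uData (by norm_num)]
  norm_num

theorem prim1_half_uData : prim1 (1 / 2) uData = 1 / 4 := by
  rw [prim1_uData (by norm_num)]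
  norm_num

theorem prim1_neg_half_uData : prim1 (-1 / 2) uData = -1 / 4 := by
  rw [prim1_uData (by norm_num)]
  norm_num

theorem abs_prim1_uData_le {x : ℝ} (hx : x ∈ Icc (-1 : ℝ) 1) : |prim1 x uData| ≤ 1 / 4 := by
  rw [prim1_uData hx, abs_le]
  obtain ⟨h1, h2⟩ := hx
  rcases le_total x (1 / 2) with h3 | h3 <;> rcases le_total x (-1 / 2) with h4 | h4 <;>
    simp only [min_eq_left, min_eq_right, h3, h4] <;> constructor <;> linarith

theorem reflect_uData : reflect uData = uData := by
  refine Lp.ext ?_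
  filter_upwards [coeFn_reflect uData, boxFun_memLp.coeFn_toLp,
    measurePreserving_neg_vol.quasiMeasurePreserving.ae_eq_comp boxFun_memLp.coeFn_toLp]
    with x h1 h2 h3
  simp only [Function.comp_apply] at h3
  rw [h1, uData, h2, h3, boxFun, boxFun]
  congr 1
  have : -x ∈ Icc (-1 / 2 : ℝ) (1 / 2) ↔ x ∈ Icc (-1 / 2 : ℝ) (1 / 2) := by
    constructor <;> rintro ⟨h4, h5⟩ <;> constructor <;> linarith
  by_cases hx : x ∈ Icc (-1 / 2 : ℝ) (1 / 2)
  · rw [indicator_of_mem hx, indicator_of_mem (this.2 hx)]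
  · rw [indicator_of_notMem hx, indicator_of_notMem (mt this.1 hx)]

theorem prim2_one_uData : prim2 1 uData = 0 := by
  have h := prim2_reflect 1 uData
  rw [reflect_uData, prim1_one_uData, prim2_eq_integral (-1), intervalIntegral.integral_same] at h
  linarith

theorem starTV_uData : starTV uData = ((1 / 4 : ℝ) : EReal) :=
  starTV_eq prim1_one_uData prim2_one_uData (fun _ => abs_prim1_uData_le) (x₀ := 1 / 2)
    (by norm_num) (.inl rfl) (by rw [prim1_half_uData, one_mul])

theorem inner_uData_self : inner ℝ uData uData = (1 / 2 : ℝ) := by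
  rw [inner_uData, prim1_one_uData, prim1_half_uData, prim1_neg_half_uData]
  norm_num

/-- The total variation minimizer is a multiple of the data. -/
theorem tvMin_one_uData {μ : ℝ≥0} (h0 : 0 < μ) (hμ : (μ : ℝ) ≤ 1 / 4) :
    tvMin 1 μ uData = uData - (4 * μ : ℝ) • uData := by
  have h0' : (0 : ℝ) < μ := h0
  refine tvMin_eq (mem_closure_testSet_one h0' ?_ ?_ fun x hx => ?_) ?_
  · rw [map_smul, prim1_one_uData, smul_zero]
  · rw [map_smul, prim2_one_uData, smul_zero]
  · rw [map_smul, smul_eq_mul, abs_mul, abs_of_pos (by positivity)]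
    nlinarith [abs_prim1_uData_le hx]
  · rintro q ⟨φ, hφ, hφμ, hq⟩
    have h1 := (abs_le.1 (hφμ (1 / 2) (by norm_num))).2
    have h2 := (abs_le.1 (hφμ (-1 / 2) (by norm_num))).1
    -- The pairing is `φ(1/2) - φ(-1/2)`, and `4μ • uData` attains the bound `2μ`.
    have h3 : inner ℝ uData q ≤ 2 * μ := by
      rw [inner_uData, prim1_of_deriv hφ hq (by norm_num), prim1_of_deriv hφ hq (x := -1 / 2)
        (by norm_num), prim1_of_deriv hφ hq (x := 1) (by norm_num),
        hφ.eq_zero_of_notMem (x := 1) (by simp)]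
      linarith
    rw [show uData - (4 * μ : ℝ) • uData = (1 - 4 * μ : ℝ) • uData by module,
      real_inner_smul_left, inner_sub_right, real_inner_smul_right, inner_uData_self]
    nlinarith

/-! ### Projections onto `feas b` -/

theorem zero_mem_feas {b : ℝ} (hb : 0 ≤ b) : (0 : L2) ∈ feas b := by
  refine ⟨map_zero _, map_zero _, fun x _ => ?_⟩
  rw [map_zero, abs_zero]
  exact hb

theorem smul_mem_feas {b c : ℝ} (hc : 0 ≤ c) {p : L2} (hp : p ∈ feas b) :
    c • p ∈ feas (c * b) := by
  refine ⟨?_, ?_, fun x hx => ?_⟩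
  · rw [map_smul, hp.1, smul_zero]
  · rw [map_smul, hp.2.1, smul_zero]
  · rw [map_smul, smul_eq_mul, abs_mul, abs_of_nonneg hc]
    exact mul_le_mul_of_nonneg_left (hp.2.2 x hx) hc

theorem convex_feas (b : ℝ) : Convex ℝ (feas b) := by
  rintro p ⟨h1, h2, h3⟩ q ⟨h4, h5, h6⟩ s t hs ht hst
  refine ⟨?_, ?_, fun x hx => ?_⟩
  · rw [map_add, map_smul, map_smul, h1, h4, smul_zero, smul_zero, add_zero]
  · rw [map_add, map_smul, map_smul, h2, h5, smul_zero, smul_zero, add_zero]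
  · rw [map_add, map_smul, map_smul, smul_eq_mul, smul_eq_mul]
    calc |s * prim2 x p + t * prim2 x q| ≤ |s * prim2 x p| + |t * prim2 x q| := abs_add_le _ _
      _ = s * |prim2 x p| + t * |prim2 x q| := by
        rw [abs_mul, abs_mul, abs_of_nonneg hs, abs_of_nonneg ht]
      _ ≤ s * b + t * b := by gcongr; exacts [h3 x hx, h6 x hx]
      _ = b := by rw [← add_mul, hst, one_mul]

theorem isClosed_feas (b : ℝ) : IsClosed (feas b) := by
  have e : feas b = {p | prim1 1 p = 0} ∩ ({p | prim2 1 p = 0} ∩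
      ⋂ x ∈ Icc (-1 : ℝ) 1, {p | |prim2 x p| ≤ b}) := by
    ext p
    simp [feas]
  rw [e]
  refine (isClosed_eq (by fun_prop) continuous_const).inter
    ((isClosed_eq (by fun_prop) continuous_const).inter ?_)
  exact isClosed_biInter fun x _ => isClosed_le (by fun_prop) continuous_const

/-- `p` is the projection of the data onto `feas b`. -/
def IsProj (b : ℝ) (p : L2) : Prop :=
  p ∈ feas b ∧ ∀ q ∈ feas b, inner ℝ (uData - p) (q - p) ≤ 0

theorem exists_isProj {b : ℝ} (hb : 0 ≤ b) : ∃ p, IsProj b p := by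
  obtain ⟨p, hp, hmin⟩ := exists_norm_eq_iInf_of_complete_convex
    ⟨0, zero_mem_feas hb⟩ (isClosed_feas b).isComplete (convex_feas b) uData
  exact ⟨p, hp, (norm_eq_iInf_iff_real_inner_le_zero (convex_feas b) hp).1 hmin⟩

theorem mem_feas_of_mem_testSet {b : ℝ} {q : L2} {φ : ℝ → ℝ} (hb : 0 ≤ b) (hφ : IsTest φ)
    (hφb : ∀ x ∈ Ioo (-1 : ℝ) 1, |φ x| ≤ b) (hq : q =ᵐ[vol] iteratedDeriv 2 φ) : q ∈ feas b := by
  have one_mem : (1 : ℝ) ∈ Icc (-1 : ℝ) 1 := by norm_num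
  refine ⟨?_, ?_, fun x hx => ?_⟩
  · rw [prim1_of_deriv_two hφ hq one_mem, hφ.deriv.eq_zero_of_notMem (by simp)]
  · rw [prim2_of_deriv_two hφ hq one_mem, hφ.eq_zero_of_notMem (by simp)]
  · rw [prim2_of_deriv_two hφ hq hx]
    by_cases hx' : x ∈ Ioo (-1 : ℝ) 1
    · exact hφb x hx'
    · rw [hφ.eq_zero_of_notMem hx', abs_zero]
      exact hb

namespace IsProj

variable {b : ℝ} {p : L2}

theorem tvMin_two {μ : ℝ≥0} (hμ : 0 < μ) (h : IsProj μ p) : tvMin 2 μ uData = uData - p := by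
  refine tvMin_eq ?_ ?_
  · refine closure_mono ?_ (mem_closure_testSet_of_bounds (a := 2 * ‖p‖ + 1) (by positivity)
      (NNReal.coe_pos.2 hμ) h.1.1 h.1.2.1 (fun x _ => (abs_prim1_le x p).trans (by linarith))
      h.1.2.2)
    rintro q ⟨φ, hφ, ⟨-, hφb⟩, hq⟩
    exact ⟨φ, hφ, hφb, hq⟩
  · rintro q ⟨φ, hφ, hφb, hq⟩
    exact h.2 q (mem_feas_of_mem_testSet μ.2 hφ hφb hq)

theorem prim1_half (h : IsProj b p) : prim1 (1 / 2) p = 1 / 2 * inner ℝ uData p := by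
  have h5 := prim1_odd_of_projection h.1 h.2 (1 / 2)
  rw [show (-(1 / 2) : ℝ) = -1 / 2 by norm_num] at h5
  rw [inner_uData, h.1.1]
  linarith

/-- The dual norm is the supremum of the primitive's modulus, attained at `1/2`. -/
theorem starTV_neg (h : IsProj b p) :
    starTV (-p) = ((1 / 2 * inner ℝ uData p : ℝ) : EReal) := by
  refine starTV_eq (by rw [map_neg, h.1.1, neg_zero]) (by rw [map_neg, h.1.2.1, neg_zero])
    (fun x hx => ?_) (x₀ := 1 / 2) (by norm_num) (.inr rfl) ?_
  · rw [map_neg, abs_neg]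
    exact abs_prim1_le_of_projection h.1 h.2 x hx
  · rw [map_neg, h.prim1_half]
    ring

theorem norm_sq_le (hb : 0 ≤ b) (h : IsProj b p) : ‖p‖ ^ 2 ≤ inner ℝ uData p := by
  have := h.2 0 (zero_mem_feas hb)
  rw [zero_sub, inner_neg_right, inner_sub_left, real_inner_self_eq_norm_sq] at this
  linarith

/-- The pairing of the data with its projection grows sublinearly in the size of the set. -/
theorem inner_uData_le {t : ℝ} (ht : 1 < t) (h : IsProj b p) {q : L2} (hq : IsProj (t * b) q) :
    inner ℝ uData q ≤ t * inner ℝ uData p := by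
  have t0 : 0 < t := by linarith
  have hq' : t⁻¹ • q ∈ feas b := by
    have := smul_mem_feas (inv_nonneg.2 t0.le) hq.1
    rwa [inv_mul_cancel_left₀ t0.ne'] at this
  -- Each projection is tested against the rescaled other one. Adding the results with weight `t`
  -- leaves `(t - 1)⟨uData, q - t • p⟩ + ‖q - t • p‖² ≤ 0`.
  have h1 := h.2 _ hq'
  have h2 := hq.2 _ (smul_mem_feas t0.le h.1)
  rw [show t⁻¹ • q - p = t⁻¹ • (q - t • p) by
    rw [smul_sub, smul_smul, inv_mul_cancel₀ t0.ne', one_smul], real_inner_smul_right] at h1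
  have h1' : inner ℝ (uData - p) (q - t • p) ≤ 0 := by
    by_contra! hcon
    exact absurd h1 (not_le.2 (mul_pos (inv_pos.2 t0) hcon))
  have h3 : t * inner ℝ (uData - p) (q - t • p) + inner ℝ (uData - q) (t • p - q) ≤ 0 := by
    nlinarith
  have h4 : t * inner ℝ (uData - p) (q - t • p) + inner ℝ (uData - q) (t • p - q) =
      (t - 1) * inner ℝ uData (q - t • p) + ‖q - t • p‖ ^ 2 := by
    rw [← real_inner_self_eq_norm_sq, show t • p - q = -(q - t • p) by abel, inner_neg_right,
      inner_sub_left uData q, inner_sub_left uData p, inner_sub_left q (t • p),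
      real_inner_smul_left]
    ring
  have h5 : inner ℝ uData (q - t • p) ≤ 0 := by
    by_contra! hcon
    nlinarith [mul_pos (sub_pos.2 ht) hcon, sq_nonneg ‖q - t • p‖]
  rw [inner_sub_right, real_inner_smul_right] at h5
  linarith

end IsProj

theorem sigma_one_coeFn (p : L2) :
    eLpNorm (sigma 1 p) ∞ vol = eLpNorm (fun x => prim1 x p) ∞ vol := by
  refine eLpNorm_congr_ae ?_
  filter_upwards [ae_restrict_mem measurableSet_Ioo] with x hx
  rw [prim1_eq_sigma p (Ioo_subset_Icc_self hx)]

theorem eLpNorm_sigma_one_le {p : L2} {C : ℝ} (h : ∀ x ∈ Icc (-1 : ℝ) 1, |prim1 x p| ≤ C) :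
    eLpNorm (sigma 1 p) ∞ vol ≤ ENNReal.ofReal C := by
  rw [sigma_one_coeFn, eLpNorm_exponent_top]
  refine eLpNormEssSup_le_of_ae_bound ?_
  filter_upwards [ae_restrict_mem measurableSet_Ioo] with x hx
  exact h x (Ioo_subset_Icc_self hx)

theorem tvMin_two_zero (f : L2) : tvMin 2 0 f = f := by
  have h : tvMin 2 0 f = f - 0 := by
    refine tvMin_eq (subset_closure ⟨0, IsTest.zero, by simp, ?_⟩) ?_
    · have e : iteratedDeriv 2 (0 : ℝ → ℝ) = 0 := by
        ext x
        simp
      rw [e]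
      exact Lp.coeFn_zero ℝ 2 vol
    · rintro q ⟨φ, hφ, hφ0, hq⟩
      have hφz : φ = 0 := by
        ext x
        by_cases hx : x ∈ Ioo (-1 : ℝ) 1
        · simpa using hφ0 x hx
        · exact hφ.eq_zero_of_notMem hx
      have hq0 : q = 0 := by
        refine Lp.ext ?_
        filter_upwards [hq, Lp.coeFn_zero ℝ 2 vol] with x h1 h2
        rw [h1, h2, hφz]
        simp
      rw [hq0, sub_self, inner_zero_right]
  rwa [sub_zero] at h

end Denoising

/-! ### The main theorem -/

open Denoising

theorem mainTheorem3 (l₁ l₂ μ₁ μ₂ : ℝ≥0) (hΛ : (l₁, l₂) ∈ Denoising.Lam Denoising.uData)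
    (h₂ : (l₂ : ℝ) = μ₁ * μ₂ / (Denoising.starTV Denoising.uData).toReal)
    (h₁ : (l₁ : ℝ) = μ₁ / (Denoising.starTV Denoising.uData).toReal *
      (Denoising.starTV (Denoising.tvMin 2 μ₂ Denoising.uData - Denoising.uData)).toReal) :
    (0 < Denoising.starTV Denoising.uData ∧ Denoising.starTV Denoising.uData < ⊤ ∧
      Denoising.starTV (Denoising.tvMin 2 μ₂ Denoising.uData - Denoising.uData) < ⊤) ∧
    ∀ u : Denoising.L2,
      Denoising.IsMinimizer (Denoising.TGV l₁ l₂) Denoising.uData u ↔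
        u = Denoising.tvMin 1 μ₁ Denoising.uData +
          ((μ₁ : ℝ) / (Denoising.starTV Denoising.uData).toReal) •
            Denoising.tvMin 2 μ₂ Denoising.uData := by
  -- For `l₂ = 0` the `TV²` minimizer is the data itself, and the first condition defining `Λ` would
  -- read `l₁ < 0`.
  have hl₂ : 0 < l₂ := by
    rw [pos_iff_ne_zero]
    rintro rfl
    refine not_lt_zero (hΛ.1.trans_le ((eLpNorm_sigma_one_le (C := 0) fun x _ => ?_).trans_eq
      ENNReal.ofReal_zero))
    rw [tvMin_two_zero, sub_self, map_zero, abs_zero]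
  have e4 : (starTV uData).toReal = 1 / 4 := by rw [starTV_uData, EReal.toReal_coe]
  rw [e4] at h₁ h₂ ⊢
  replace h₂ : (l₂ : ℝ) = 4 * μ₁ * μ₂ := by rw [h₂]; ring
  have hl₂' : (0 : ℝ) < l₂ := hl₂
  have hμ₁ : 0 < μ₁ := by
    rw [pos_iff_ne_zero]
    rintro rfl
    simp [h₂] at hl₂'
  have hμ₂ : 0 < μ₂ := by
    rw [pos_iff_ne_zero]
    rintro rfl
    simp [h₂] at hl₂'
  have hμ₁' : (0 : ℝ) < μ₁ := hμ₁
  have hμ₂' : (0 : ℝ) < μ₂ := hμ₂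
  obtain ⟨p, hp⟩ := exists_isProj μ₂.2
  have hv : tvMin 2 μ₂ uData - uData = -p := by
    rw [hp.tvMin_two hμ₂]
    abel
  rw [hv, hp.starTV_neg, EReal.toReal_coe] at h₁
  replace h₁ : (l₁ : ℝ) = 2 * μ₁ * inner ℝ uData p := by rw [h₁]; ring
  -- Otherwise `l₂ = tμ₂` with `t = 4μ₁ > 1`, and sublinear growth gives `½⟨uData, q⟩ ≤ l₁` for the
  -- projection `q` onto `feas l₂`.
  have hle : (μ₁ : ℝ) ≤ 1 / 4 := by
    by_contra! hcon
    obtain ⟨q, hq⟩ := exists_isProj l₂.2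
    have hq' : IsProj (4 * μ₁ * μ₂) q := by rwa [← h₂]
    have h3 := hp.inner_uData_le (by linarith) hq'
    refine absurd hΛ.1 (not_lt.2 ?_)
    refine (eLpNorm_sigma_one_le (C := l₁) fun x hx => ?_).trans_eq (ENNReal.ofReal_coe_nnreal)
    rw [hq.tvMin_two hl₂, show uData - q - uData = -q by abel, map_neg, abs_neg]
    refine (abs_prim1_le_of_projection hq.1 hq.2 x hx).trans ?_
    rw [h₁]
    linarith
  refine ⟨⟨?_, ?_, ?_⟩, fun u => ?_⟩
  · rw [starTV_uData]
    exact_mod_cast (by norm_num : (0 : ℝ) < 1 / 4)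
  · rw [starTV_uData]
    exact EReal.coe_lt_top _
  · rw [hv, hp.starTV_neg]
    exact EReal.coe_lt_top _
  have e : tvMin 1 μ₁ uData + ((μ₁ : ℝ) / (1 / 4)) • tvMin 2 μ₂ uData =
      uData - (4 * μ₁ : ℝ) • p := by
    rw [tvMin_one_uData hμ₁ hle, hp.tvMin_two hμ₂]
    module
  rw [e]
  have hb : ∀ x ∈ Icc (-1 : ℝ) 1, |prim1 x ((4 * μ₁ : ℝ) • p)| ≤ l₁ := by
    intro x hx
    rw [map_smul, smul_eq_mul, abs_mul, abs_of_pos (by positivity), h₁]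
    nlinarith [abs_prim1_le_of_projection hp.1 hp.2 x hx]
  have hmem : (4 * μ₁ : ℝ) • p ∈ feas l₂ := by
    rw [h₂]
    exact smul_mem_feas (by positivity) hp.1
  refine isMinimizer_iff (TGV_eq_iSup l₁ l₂) ?_ ?_ u
  -- The approximation lemma needs a positive slope bound. If `l₁ = 0`, then `⟨uData, p⟩ = 0`, and
  -- `‖p‖² ≤ ⟨uData, p⟩` forces `p = 0`.
  · rcases eq_or_lt_of_le l₁.2 with h0 | h0
    · have hp0 : p = 0 := by
        have h3 : inner ℝ uData p = (0 : ℝ) := by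
          have h4 : 2 * μ₁ * inner ℝ uData p = (0 : ℝ) := by rw [← h₁]; exact h0.symm
          exact (mul_eq_zero.1 h4).resolve_left (by positivity)
        have h5 := hp.norm_sq_le μ₂.2
        rw [h3] at h5
        exact norm_eq_zero.1 (pow_eq_zero_iff two_ne_zero |>.1 (le_antisymm h5 (by positivity)))
      refine subset_closure ⟨0, IsTest.zero, ⟨by simp, by simp⟩, ?_⟩
      have e0 : iteratedDeriv 2 (0 : ℝ → ℝ) = 0 := by
        ext x
        simp
      rw [hp0, smul_zero, e0]
      exact Lp.coeFn_zero ℝ 2 vol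
    · exact mem_closure_testSet_of_bounds h0 hl₂' hmem.1 hmem.2.1 hb hmem.2.2
  · rintro q ⟨φ, hφ, ⟨hφ₁, hφ₂⟩, hq⟩
    have c0 : (0 : ℝ) < 4 * μ₁ := by positivity
    have h1 := (abs_le.1 (hφ₁ (1 / 2) (by norm_num))).2
    have h2 := (abs_le.1 (hφ₁ (-1 / 2) (by norm_num))).1
    have h3 : inner ℝ uData q ≤ 2 * l₁ := by
      rw [inner_uData, prim1_of_deriv_two hφ hq (by norm_num),
        prim1_of_deriv_two hφ hq (x := -1 / 2) (by norm_num),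
        prim1_of_deriv_two hφ hq (x := 1) (by norm_num),
        hφ.deriv.eq_zero_of_notMem (x := 1) (by simp)]
      linarith
    have hq' : (4 * μ₁ : ℝ)⁻¹ • q ∈ feas μ₂ := by
      have := smul_mem_feas (inv_nonneg.2 c0.le) (mem_feas_of_mem_testSet l₂.2 hφ hφ₂ hq)
      rwa [NNReal.val_eq_coe, h₂, inv_mul_cancel_left₀ c0.ne'] at this
    have h4 := hp.2 _ hq'
    rw [show (4 * μ₁ : ℝ)⁻¹ • q - p = (4 * μ₁ : ℝ)⁻¹ • (q - (4 * μ₁ : ℝ) • p) by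
      rw [smul_sub, smul_smul, inv_mul_cancel₀ c0.ne', one_smul], real_inner_smul_right] at h4
    have h5 : inner ℝ (uData - p) (q - (4 * μ₁ : ℝ) • p) ≤ 0 := by
      by_contra! hcon
      exact absurd h4 (not_le.2 (mul_pos (inv_pos.2 c0) hcon))
    have h6 : inner ℝ uData (q - (4 * μ₁ : ℝ) • p) ≤ 0 := by
      rw [inner_sub_right, real_inner_smul_right]
      linarith
    -- Both coefficients are nonnegative because `0 < μ₁ ≤ 1/4`, and `h6` and `h5` settle the two
    -- terms.
    rw [show uData - (4 * μ₁ : ℝ) • p =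
      (1 - 4 * μ₁ : ℝ) • uData + (4 * μ₁ : ℝ) • (uData - p) by module, inner_add_left,
      real_inner_smul_left, real_inner_smul_left]
    nlinarith
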